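/- Let $n\ge 1$, $0\le l\le n$ and $\alpha>0$. Let $\Lambda_n=\mathbb{Z}e_1+\cdots+\mathbb{Z}e_n\subset\mathbb{R}^n$ and, for $m=(m_1,\dots,m_n)\in\mathbb{Z}^n$, put $$g_m(x)=(x_1+m_1,\dots,x_{n-1}+m_{n-1},(-1)^{m_n}x_n+m_n),\qquad \chi(m)=(-1)^{m_1+\cdots+m_l}.$$ Let $\mathcal{K}_n=\mathbb{R}^n/\!\sim^*$ be the quotient by the relation $x\sim^* g_m(x)$ $(m\in\mathbb{Z}^n)$, with projection $p_*$, and with the volume induced by Lebesgue measure on the cell $[-\frac12,\frac12]^n$. Let $Cl_n(\mathbb{C})$ be the complexification of the Clifford algebra $Cl_{n,0}$ or $Cl_{0,n}$, and let $\mathcal{E}^{(q)}$ be the pinor bundle over $\mathcal{K}_n$ obtained from $\mathbb{R}^n\times Cl_n(\mathbb{C})$ by identifying $(x,X)$ with $(g_m(x),\chi(m)X)$ for all $m$. A function $u$ on $\mathbb{R}^n$ with values in $Cl_n(\mathbb{C})$ (or in $\mathbb{C}\subset Cl_n(\mathbb{C})$) satisfying $u(g_m(x))=\chi(m)u(x)$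 for all $m$ descends to a section $p_*(u)$ of $\mathcal{E}^{(q)}$, called smooth if $u$ is smooth, and $\Delta-\alpha^2$ induces the Klein-Gordon operator $\Delta'_\alpha\,p_*(u)=p_*((\Delta-\alpha^2)u)$. Let $$E_\alpha(x)=-\frac{i\pi}{2\omega_n\Gamma(n/2)}\Big(\tfrac12 i\alpha\Big)^{\frac n2-1}|x|^{1-\frac n2}H^{(1)}_{\frac n2-1}(i\alpha|x|),$$ where $\omega_n$ is the surface measure of the unit sphere of $\mathbb{R}^n$ and $H^{(1)}_\nu$ is the first Hankel function, and let $$\wp(x)=\sum_{m\in\mathbb{Z}^n}(-1)^{m_1+\cdots+m_l}\,E_\alpha(x_1+m_1,\dots,x_{n-1}+m_{n-1},(-1)^{m_n}x_n+m_n).$$ Then: 1. The series converges normally on $\mathbb{R}^n\setminus\Lambda_n$: on each compact subset of $\mathbb{R}^n\setminus\Lambda_n$ its terms are bounded in absolute value by the terms of a summable family of constants. 2. $\wp$ is smooth and satisfies $(\Delta-\alpha^2)\wp=0$ on $\mathbb{R}^n\setminus\Lambda_n$. 3. $\wp(x+k)=(-1)^{k_1+\cdots+k_l}\,\wp(x_1,\dots,x_{n-1},(-1)^{k_n}x_n)$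 for all $k\in\mathbb{Z}^n$ (for $l=0$, the trivial bundle, there is no sign). 4. $\wp$ descends to a section $E'_{\alpha,q}=p_*(\wp)$ of $\mathcal{E}^{(q)}$, and $E'_{\alpha,q}$ is a fundamental solution of the Klein-Gordon operator on sections of $\mathcal{E}^{(q)}$, with pole at $p_*(0)$: it is integrable, and $\int_{\mathcal{K}_n}E'_{\alpha,q}\;\Delta'_\alpha\psi'\,dV=\psi(0)$ for every smooth section $\psi'=p_*(\psi)$ of $\mathcal{E}^{(q)}$. (The values assigned to $E_\alpha(0)$, and so to $\wp$ on $\Lambda_n$, are immaterial; in 3 and 4 any fixed value of $E_\alpha(0)$ may be taken.) -/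

import Mathlib

open scoped TensorProduct ContDiff Laplacian InnerProductSpace
open MeasureTheory

noncomputable section

namespace PinorKlein

/-! ### The Euclidean fundamental solution -/

/-- Euclidean space `ℝⁿ`. -/
abbrev Euc (n : ℕ) : Type := EuclideanSpace ℝ (Fin n)

/-- The first Hankel function `H_ν⁽¹⁾(z)` on the upper half plane `Im z > 0` (the only place
where it is used), given by Sommerfeld's integral
`H_ν⁽¹⁾(z) = (e^{-νπi/2} / (πi)) ∫_{-∞}^{∞} e^{i z cosh t - ν t} dt`. -/
def hankelOne (ν : ℝ) (z : ℂ) : ℂ :=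
  Complex.exp (-(ν * Real.pi * Complex.I / 2)) / (Real.pi * Complex.I) *
    ∫ t : ℝ, Complex.exp (Complex.I * z * Real.cosh t - ν * t)

/-- The surface measure `ω_n` of the unit sphere of `ℝⁿ`. -/
def sphereArea (n : ℕ) : ℝ :=
  ((volume : Measure (Euc n)).toSphere).real Set.univ

/-- `E_α(x) = - (iπ / (2 ω_n Γ(n/2))) (iα/2)^{n/2-1} |x|^{1-n/2} H⁽¹⁾_{n/2-1}(iα|x|)`. -/
def euclidKernel (n : ℕ) (α : ℝ) (x : Euc n) : ℂ :=
  -((Complex.I * Real.pi) / (2 * sphereArea n * Real.Gamma ((n : ℝ) / 2))) *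
    ((1 / 2 : ℂ) * Complex.I * α) ^ ((n : ℂ) / 2 - 1) *
    ((‖x‖ ^ (1 - (n : ℝ) / 2) : ℝ) : ℂ) *
    hankelOne ((n : ℝ) / 2 - 1) (Complex.I * α * ‖x‖)

/-! ### The transformations defining the Klein bottle -/

/-- The lattice point `m₁ e₁ + ⋯ + mₙ eₙ`. -/
def latticeVec {n : ℕ} (m : Fin n → ℤ) : Euc n := WithLp.toLp 2 (fun i => (m i : ℝ))

/-- The lattice `Λ_n = ℤ e₁ + ⋯ + ℤ eₙ`. -/
def lattice (n : ℕ) : Set (Euc n) := Set.range (latticeVec (n := n))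

/-- `(-1)^{mₙ}` in the last coordinate and `1` in the others. -/
def lastSign {n : ℕ} (m : Fin n → ℤ) (i : Fin n) : ℤ :=
  if (i : ℕ) + 1 = n then ((m i).negOnePow : ℤ) else 1

/-- `x ↦ (x₁, …, x_{n-1}, (-1)^{mₙ} xₙ)`. -/
def reflectLast {n : ℕ} (m : Fin n → ℤ) (x : Euc n) : Euc n :=
  WithLp.toLp 2 (fun i => (lastSign m i : ℝ) * x i)

/-- `x ↦ (x₁ + m₁, …, x_{n-1} + m_{n-1}, (-1)^{mₙ} xₙ + mₙ)`. -/
def kleinMap {n : ℕ} (m : Fin n → ℤ) (x : Euc n) : Euc n := reflectLast m x + latticeVec m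

/-- The sign `(-1)^{m₁ + ⋯ + m_l}`. -/
def paritySign {n : ℕ} (l : ℕ) (m : Fin n → ℤ) : ℂ :=
  (-1 : ℂ) ^ (∑ i ∈ Finset.univ.filter (fun i : Fin n => (i : ℕ) < l), m i)

/-- The index of the composition `kleinMap k ∘ kleinMap m`. -/
def kleinComp {n : ℕ} (k m : Fin n → ℤ) : Fin n → ℤ := fun i => lastSign k i * m i + k i

/-- The index of the inverse of `kleinMap m`. -/
def kleinInv {n : ℕ} (m : Fin n → ℤ) : Fin n → ℤ := fun i => -(lastSign m i * m i)

theorem lastSign_cases {n : ℕ} (m : Fin n → ℤ) (i : Fin n) :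
    lastSign m i = 1 ∨ lastSign m i = -1 := by
  unfold lastSign
  split_ifs
  · rcases Int.units_eq_one_or (m i).negOnePow with h | h <;> simp [h]
  · simp

theorem lastSign_mul_self {n : ℕ} (m : Fin n → ℤ) (i : Fin n) :
    lastSign m i * lastSign m i = 1 := by
  rcases lastSign_cases m i with h | h <;> simp [h]

theorem negOnePow_lastSign_mul {n : ℕ} (k m : Fin n → ℤ) (i : Fin n) (a : ℤ) :
    (lastSign k i * m i + a).negOnePow = (m i).negOnePow * a.negOnePow := by
  rcases lastSign_cases k i with h | h <;> simp [h, Int.negOnePow_add, Int.negOnePow_neg]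

theorem lastSign_kleinComp {n : ℕ} (k m : Fin n → ℤ) (i : Fin n) :
    lastSign (kleinComp k m) i = lastSign k i * lastSign m i := by
  have h := negOnePow_lastSign_mul k m i (k i)
  by_cases hi : (i : ℕ) + 1 = n
  · have e : ∀ p : Fin n → ℤ, lastSign p i = ((p i).negOnePow : ℤ) := fun p => if_pos hi
    rw [e (kleinComp k m), kleinComp, h, e k, e m, Units.val_mul, mul_comm]
  · have e : ∀ p : Fin n → ℤ, lastSign p i = 1 := fun p => if_neg hi
    simp [e]

theorem kleinMap_kleinMap {n : ℕ} (k m : Fin n → ℤ) (x : Euc n) :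
    kleinMap k (kleinMap m x) = kleinMap (kleinComp k m) x := by
  ext i
  simp [kleinMap, reflectLast, latticeVec, lastSign_kleinComp, kleinComp]
  ring

theorem kleinMap_zero {n : ℕ} (x : Euc n) : kleinMap 0 x = x := by
  ext i
  simp [kleinMap, reflectLast, latticeVec, lastSign]

theorem kleinComp_inv {n : ℕ} (m : Fin n → ℤ) : kleinComp (kleinInv m) m = 0 := by
  funext i
  have h : lastSign (kleinInv m) i = lastSign m i := by
    by_cases hi : (i : ℕ) + 1 = n
    · have e : ∀ p : Fin n → ℤ, lastSign p i = ((p i).negOnePow : ℤ) := fun p => if_pos hi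
      have h2 := negOnePow_lastSign_mul m m i 0
      rw [e (kleinInv m), kleinInv, Int.negOnePow_neg]
      rw [add_zero] at h2
      rw [h2, e m]
      simp
    · have e : ∀ p : Fin n → ℤ, lastSign p i = 1 := fun p => if_neg hi
      rw [e, e]
  simp [kleinComp, h, kleinInv]

theorem paritySign_kleinComp {n : ℕ} (l : ℕ) (k m : Fin n → ℤ) :
    paritySign l (kleinComp k m) = paritySign l k * paritySign l m := by
  have h : ∀ p : Fin n → ℤ,
      paritySign l p = (((∑ i ∈ Finset.univ.filter (fun i : Fin n => (i : ℕ) < l), p i).negOnePow : ℤ) : ℂ) := fun p =>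
    (Int.cast_negOnePow ℂ _).symm
  have hs : ∀ (s : Finset (Fin n)),
      (∑ i ∈ s, kleinComp k m i).negOnePow =
        (∑ i ∈ s, k i).negOnePow * (∑ i ∈ s, m i).negOnePow := by
    classical
    intro s
    induction s using Finset.induction_on with
    | empty => simp
    | insert a s ha ih =>
      rw [Finset.sum_insert ha, Finset.sum_insert ha, Finset.sum_insert ha, Int.negOnePow_add,
        Int.negOnePow_add, Int.negOnePow_add, ih, kleinComp, negOnePow_lastSign_mul]
      ac_rfl
  rw [h, h, h, hs]
  push_cast
  ring

theorem paritySign_zero {n : ℕ} (l : ℕ) : paritySign l (0 : Fin n → ℤ) = 1 := by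
  simp [paritySign]

theorem paritySign_cases {n : ℕ} (l : ℕ) (m : Fin n → ℤ) :
    paritySign l m = 1 ∨ paritySign l m = -1 := by
  unfold paritySign
  rcases Int.even_or_odd (∑ i ∈ Finset.univ.filter (fun i : Fin n => (i : ℕ) < l), m i) with h | h
  · exact Or.inl h.neg_one_zpow
  · exact Or.inr h.neg_one_zpow

/-- The relation `∼*`: two points are equivalent when some `kleinMap m` takes one to the other. -/
def kleinSetoid (n : ℕ) : Setoid (Euc n) where
  r x y := ∃ m : Fin n → ℤ, y = kleinMap m x
  iseqv :=
    { refl := fun x => ⟨0, (kleinMap_zero x).symm⟩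
      symm := by
        rintro x y ⟨m, rfl⟩
        exact ⟨kleinInv m, by rw [kleinMap_kleinMap, kleinComp_inv, kleinMap_zero]⟩
      trans := by
        rintro x y z ⟨m, rfl⟩ ⟨k, rfl⟩
        exact ⟨kleinComp k m, kleinMap_kleinMap k m x⟩ }

/-- `𝒦_n = ℝⁿ / ∼*`, with its quotient topology and quotient σ-algebra. -/
abbrev KleinBottle (n : ℕ) : Type := Quotient (kleinSetoid n)

/-- The projection `p_* : ℝⁿ → 𝒦_n` on points. -/
def toKlein {n : ℕ} (x : Euc n) : KleinBottle n := Quotient.mk (kleinSetoid n) x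

theorem measurable_toKlein {n : ℕ} : Measurable (toKlein (n := n)) := fun _ ht => ht

/-- The cell `[-1/2, 1/2]ⁿ`. It meets every orbit of the maps `kleinMap m`, and two distinct
points of it in the same orbit lie on its boundary. -/
def kleinCell (n : ℕ) : Set (Euc n) := {x | ∀ i, x i ∈ Set.Icc (-1 / 2 : ℝ) (1 / 2)}

/-- The volume of `𝒦_n`: the image of Lebesgue measure on the cell. -/
def kleinVolume (n : ℕ) : Measure (KleinBottle n) :=
  ((volume : Measure (Euc n)).restrict (kleinCell n)).map toKlein

/-! ### The pinor bundles -/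

/-- The quadratic form of signature `(n,0)` (`ε = 1`) or `(0,n)` (`ε = -1`). -/
abbrev signedForm (n : ℕ) (ε : ℤˣ) : QuadraticForm ℝ (Fin n → ℝ) :=
  QuadraticMap.weightedSumSquares ℝ (fun _ : Fin n => ((ε : ℤ) : ℝ))

/-- `Cl_n(ℂ)`: the complexification of `Cl_{n,0}` or of `Cl_{0,n}`. -/
abbrev Cl (n : ℕ) (ε : ℤˣ) : Type := ℂ ⊗[ℝ] CliffordAlgebra (signedForm n ε)

/-- A complex basis of `Cl_n(ℂ)`, indexed by the subsets of `{1, …, n}`. -/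
def clBasis (n : ℕ) (ε : ℤˣ) : Module.Basis (Finset (Fin n)) ℂ (Cl n ε) :=
  letI : Invertible (2 : ℝ) := invertibleOfNonzero two_ne_zero
  Algebra.TensorProduct.basis ℂ
    (((Pi.basisFun ℝ (Fin n)).ExteriorAlgebra).map
      (CliffordAlgebra.equivExterior (signedForm n ε)).symm)

/-- The `S`-th scalar component of an element of `Cl_n(ℂ)`. -/
def clCoord {n : ℕ} {ε : ℤˣ} (S : Finset (Fin n)) : Cl n ε →ₗ[ℂ] ℂ := (clBasis n ε).coord S

/-- The relation `(x, X) ∼ (kleinMap m x, (-1)^{m₁+⋯+m_l} X)` on `ℝⁿ × Cl_n(ℂ)`. -/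
def pinorSetoid (n l : ℕ) (ε : ℤˣ) : Setoid (Euc n × Cl n ε) where
  r a b := ∃ m : Fin n → ℤ, b.1 = kleinMap m a.1 ∧ b.2 = paritySign l m • a.2
  iseqv :=
    { refl := fun a => ⟨0, (kleinMap_zero a.1).symm, by rw [paritySign_zero, one_smul]⟩
      symm := by
        rintro ⟨x, X⟩ ⟨y, Y⟩ ⟨m, hx, hX⟩
        dsimp only at hx hX
        subst hx hX
        exact ⟨kleinInv m,
          by rw [kleinMap_kleinMap, kleinComp_inv, kleinMap_zero],
          by rw [smul_smul, ← paritySign_kleinComp, kleinComp_inv, paritySign_zero, one_smul]⟩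
      trans := by
        rintro ⟨x, X⟩ ⟨y, Y⟩ ⟨z, Z⟩ ⟨m, hx, hX⟩ ⟨k, hy, hY⟩
        dsimp only at hx hX hy hY
        subst hx hX hy hY
        exact ⟨kleinComp k m, kleinMap_kleinMap k m x,
          by rw [smul_smul, ← paritySign_kleinComp]⟩ }

/-- The total space of the pinor bundle `𝓔^{(q)}` over `𝒦_n`. -/
abbrev PinorBundle (n l : ℕ) (ε : ℤˣ) : Type := Quotient (pinorSetoid n l ε)

/-- The bundle projection `𝓔^{(q)} → 𝒦_n`. -/
def bundleProj {n l : ℕ} {ε : ℤˣ} : PinorBundle n l ε → KleinBottle n :=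
  Quotient.lift (fun a : Euc n × Cl n ε => toKlein a.1) (by
    rintro a b ⟨m, hx, -⟩
    exact Quotient.sound ⟨m, hx⟩)

/-- The invariance under which a function on `ℝⁿ` descends to a section of `𝓔^{(q)}`. -/
def IsEquivariant {n : ℕ} {V : Type*} [SMul ℂ V] (l : ℕ) (f : Euc n → V) : Prop :=
  ∀ (m : Fin n → ℤ) (x : Euc n), f (kleinMap m x) = paritySign l m • f x

/-- The lifts to `ℝⁿ` of the sections of `𝓔^{(q)}`. -/
abbrev PinorLift (n l : ℕ) (ε : ℤˣ) : Type := {u : Euc n → Cl n ε // IsEquivariant l u}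

/-- `p_*` on functions: the section of `𝓔^{(q)}` represented by an equivariant function. -/
def descend {n l : ℕ} {ε : ℤˣ} (u : PinorLift n l ε) : KleinBottle n → PinorBundle n l ε :=
  Quotient.lift (fun x => Quotient.mk (pinorSetoid n l ε) (x, u.1 x)) (by
    rintro x y ⟨m, rfl⟩
    exact Quotient.sound ⟨m, rfl, u.2 m x⟩)

theorem bundleProj_descend {n l : ℕ} {ε : ℤˣ} (u : PinorLift n l ε) (x' : KleinBottle n) :
    bundleProj (descend u x') = x' := by
  induction x' using Quotient.inductionOn with
  | h x => rfl

/-- A complex-valued equivariant function as a pinor section, through `ℂ ⊆ Cl_n(ℂ)`. -/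
def scalarLift {n l : ℕ} (ε : ℤˣ) (f : Euc n → ℂ) (hf : IsEquivariant l f) : PinorLift n l ε :=
  ⟨fun x => algebraMap ℂ (Cl n ε) (f x), fun m x => by
    simp only [hf m x, smul_eq_mul, map_mul]
    exact (Algebra.smul_def (paritySign l m) (algebraMap ℂ (Cl n ε) (f x))).symm⟩

/-- Smooth sections: all scalar components of the lift are smooth. -/
def PinorLift.IsSmooth {n l : ℕ} {ε : ℤˣ} (u : PinorLift n l ε) : Prop :=
  ∀ S : Finset (Fin n), ContDiff ℝ ∞ (fun x => clCoord S (u.1 x))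

/-! ### The Klein-Gordon operator -/

/-- `Δ - α²` on complex-valued functions on `ℝⁿ`. -/
def kleinGordon {n : ℕ} (α : ℝ) (f : Euc n → ℂ) (x : Euc n) : ℂ := Δ f x - (α : ℂ) ^ 2 * f x

/-- `reflectLast m` as a linear isometry. -/
def reflectIso {n : ℕ} (m : Fin n → ℤ) : Euc n ≃ₗᵢ[ℝ] Euc n :=
  LinearIsometryEquiv.piLpCongrRight 2 (fun i =>
    if lastSign m i = 1 then LinearIsometryEquiv.refl ℝ ℝ else LinearIsometryEquiv.neg ℝ)

theorem reflectIso_apply {n : ℕ} (m : Fin n → ℤ) (x : Euc n) :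
    reflectIso m x = reflectLast m x := by
  ext i
  rcases lastSign_cases m i with h | h <;>
    simp [reflectIso, reflectLast, LinearIsometryEquiv.piLpCongrRight_apply, h]

theorem kleinGordon_comp_kleinMap {n : ℕ} (α : ℝ) (f : Euc n → ℂ) (m : Fin n → ℤ) (x : Euc n) :
    kleinGordon α (fun y => f (kleinMap m y)) x = kleinGordon α f (kleinMap m x) := by
  have key : Δ (fun y => f (kleinMap m y)) x = Δ f (kleinMap m x) := by
    have h1 : (fun y => f (kleinMap m y)) =
        (fun z => f (z + latticeVec m)) ∘ (reflectIso m).toContinuousLinearEquiv := by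
      funext y
      simp [kleinMap, reflectIso_apply]
    rw [h1, InnerProductSpace.laplacian_eq_iteratedFDeriv_orthonormalBasis _
        (EuclideanSpace.basisFun (Fin n) ℝ),
      InnerProductSpace.laplacian_eq_iteratedFDeriv_orthonormalBasis f
        ((EuclideanSpace.basisFun (Fin n) ℝ).map (reflectIso m))]
    refine Finset.sum_congr rfl fun i _ => ?_
    have h2 := ContinuousLinearEquiv.iteratedFDerivWithin_comp_right
      (reflectIso m).toContinuousLinearEquiv (fun z => f (z + latticeVec m))
      (s := Set.univ) uniqueDiffOn_univ (x := x) (Set.mem_univ _) 2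
    rw [Set.preimage_univ, iteratedFDerivWithin_univ, iteratedFDerivWithin_univ,
      iteratedFDeriv_comp_add_right] at h2
    rw [h2, ContinuousMultilinearMap.compContinuousLinearMap_apply]
    congr 1
    · congr 1
      simp [kleinMap, reflectIso_apply]
    · funext j
      fin_cases j <;> rfl
  simp only [kleinGordon, key]

theorem kleinGordon_equivariant {n l : ℕ} (α : ℝ) (f : Euc n → ℂ) (hf : IsEquivariant l f) :
    IsEquivariant l (kleinGordon α f) := by
  intro m x
  rw [← kleinGordon_comp_kleinMap]
  have h : (fun y => f (kleinMap m y)) = fun y => paritySign l m • f y := funext (hf m)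
  rw [h]
  rcases paritySign_cases l m with hs | hs
  · simp [hs]
  · have hn : (fun y => (-1 : ℂ) • f y) = -f := by
      funext y
      simp
    rw [hs, hn, kleinGordon, InnerProductSpace.laplacian_neg]
    simp [kleinGordon]
    ring

theorem clCoord_equivariant {n l : ℕ} {ε : ℤˣ} (u : PinorLift n l ε) (S : Finset (Fin n)) :
    IsEquivariant l (fun x => clCoord S (u.1 x)) := by
  intro m x
  simp only [u.2 m x, map_smul]

/-- The Klein-Gordon operator induced by `Δ - α²` on the sections of `𝓔^{(q)}`; it is a scalar
operator and acts on each scalar component. -/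
def pinorKleinGordon {n l : ℕ} {ε : ℤˣ} (α : ℝ) (u : PinorLift n l ε) : PinorLift n l ε :=
  ⟨fun x => ∑ S, kleinGordon α (fun y => clCoord S (u.1 y)) x • clBasis n ε S, fun m x => by
    simp only [Finset.smul_sum, smul_smul]
    refine Finset.sum_congr rfl fun S _ => ?_
    rw [kleinGordon_equivariant α _ (clCoord_equivariant u S) m x, smul_eq_mul]⟩

/-! ### Fundamental solutions -/

/-- The product (in the Clifford algebra) of two sections of `𝓔^{(q)}`: the signs cancel, and it
is a function on `𝒦_n`. -/
def sectionMul {n l : ℕ} {ε : ℤˣ} (u v : PinorLift n l ε) : KleinBottle n → Cl n ε :=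
  Quotient.lift (fun x => u.1 x * v.1 x) (by
    rintro x y ⟨m, rfl⟩
    have hs : paritySign l m * paritySign l m = 1 := by
      rcases paritySign_cases l m with hs | hs <;> simp [hs]
    rw [u.2 m x, v.2 m x, smul_mul_smul_comm, hs, one_smul])

/-- The integral over `𝒦_n` of a `Cl_n(ℂ)`-valued function, taken in each component. -/
def kleinIntegral {n : ℕ} {ε : ℤˣ} (g : KleinBottle n → Cl n ε) : Cl n ε :=
  ∑ S, (∫ x', clCoord S (g x') ∂(kleinVolume n)) • clBasis n ε S

/-- `s` is a fundamental solution, with pole `p_*(0)`, of the Klein-Gordon operator on the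
sections of `𝓔^{(q)}`: it is an integrable section with `(Δ' - α²) s = δ` in the sense of
distributions, that is, `∫ s (Δ' - α²) ψ dV = ψ(0)` for all smooth sections `ψ`. -/
def IsFundamentalSolution {n l : ℕ} {ε : ℤˣ} (α : ℝ) (s : KleinBottle n → PinorBundle n l ε) :
    Prop :=
  ∃ F : PinorLift n l ε, descend F = s ∧
    (∀ S : Finset (Fin n), IntegrableOn (fun x => clCoord S (F.1 x)) (kleinCell n)) ∧
    ∀ ψ : PinorLift n l ε, ψ.IsSmooth →
      kleinIntegral (sectionMul F (pinorKleinGordon α ψ)) = ψ.1 0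

/-- The term `(-1)^{m₁+⋯+m_l} E_α(x₁+m₁, …, x_{n-1}+m_{n-1}, (-1)^{mₙ}xₙ+mₙ)`. -/
def twistedTerm {n : ℕ} (l : ℕ) (α : ℝ) (m : Fin n → ℤ) (x : Euc n) : ℂ :=
  paritySign l m * euclidKernel n α (kleinMap m x)

/-- The twisted lattice sum over `Λ_n`; for `l = 0` it is `℘_α`. -/
def twistedSum {n : ℕ} (l : ℕ) (α : ℝ) (x : Euc n) : ℂ :=
  ∑' m : Fin n → ℤ, twistedTerm l α m x

end PinorKlein

end

open PinorKlein

/-!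
With `s = t²` the Sommerfeld integral of the Hankel function becomes a heat integral: for `x ≠ 0`,
`E_α(x) = -∫_0^∞ e^{-α²s} (4πs)^{-n/2} e^{-|x|²/(4s)} ds`, a constant multiple of the radial
integral `J_{n-1}(|x|²)`, where `J_k(w) = ∫_0^∞ t^{-k} e^{-α²t² - w/(4t²)} dt`
(`euclidKernel_eq`). All four claims are read off from this representation.

The family `J_k` is closed under differentiation, `J_k' = -J_{k+2}/4`, and away from `w = 0` all its
members decay faster than any power of `√w`; hence so do all derivatives of `E_α` away from the
origin. A compact set disjoint from the lattice stays at a positive distance from the origin under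
all the isometries `kleinMap m`, so the twisted series and all its termwise derivatives are
dominated by multiples of `∑ (1 + |m|)^{-(n+1)}`
(`exists_summable_norm_iteratedFDeriv_twistedTerm_le`). This gives normal convergence, smoothness
and termwise application of `Δ - α²`. Each term is annihilated by `Δ - α²` because of the identity
`besselInt_recurrence`, an integration by parts in `t`.

Equivariance is a reindexing of the sum by the group law of the maps `kleinMap m`
(`isEquivariant_twistedSum`), and pseudo-periodicity is a restatement of it.

For the fundamental solution, the images of the cell under the maps `kleinMap m` are the unit cubes
centred at the lattice points, so the integral of `℘ · (Δ - α²)ψ` over the cell unfolds to the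
integral of `E_α · (Δ - α²)ψ` over `ℝⁿ` (`setIntegral_twistedSum_mul`). An equivariant `ψ` is
`2ℤⁿ`-periodic, so its derivatives are bounded, and Fubini and a rescaling turn the latter integral
into `-∫_0^∞ 2t e^{-α²t²} A(t) dt`, where `A(t)` averages `(Δ - α²)ψ` at `ty` against the Gaussian
density in `y`. By integration by parts in space the integrand is the derivative of `e^{-α²t²}`
times the average of `ψ(ty)`, which runs from `ψ(0)` at `t = 0` to `0` at infinity
(`integral_euclidKernel_mul_kleinGordon`).
-/

namespace PinorKlein

/-! ### Series of smooth functions on an open set -/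

section Series

variable {ι E F : Type*} [NormedAddCommGroup E] [NormedSpace ℝ E] [NormedAddCommGroup F]
  [NormedSpace ℝ F] {f : ι → E → F} {v : ℕ → ι → ℝ} {U : Set E}

theorem hasFDerivAt_iteratedFDeriv {g : E → F} (hU : IsOpen U) (hg : ContDiffOn ℝ ∞ g U) (k : ℕ)
    {x : E} (hx : x ∈ U) :
    HasFDerivAt (iteratedFDeriv ℝ k g) (fderiv ℝ (iteratedFDeriv ℝ k g) x) x := by
  have h := hg.contDiffAt (hU.mem_nhds hx)
  exact ((h.iteratedFDeriv_right (i := k) (m := 1) (by exact_mod_cast le_top)).differentiableAt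
    one_ne_zero).hasFDerivAt

variable [CompleteSpace F]

/-- On a preconnected open set, a series of smooth functions all of whose derivatives are dominated
by summable constants can be differentiated termwise to any order. -/
theorem iteratedFDeriv_tsum_of_isPreconnected (hU : IsOpen U) (hUc : IsPreconnected U)
    (hf : ∀ i, ContDiffOn ℝ ∞ (f i) U) (hv : ∀ k, Summable (v k))
    (hb : ∀ k i, ∀ x ∈ U, ‖iteratedFDeriv ℝ k (f i) x‖ ≤ v k i) (k : ℕ) :
    ∀ x ∈ U, iteratedFDeriv ℝ k (fun y => ∑' i, f i y) x = ∑' i, iteratedFDeriv ℝ k (f i) x := by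
  induction k with
  | zero =>
    intro x _
    simp_rw [iteratedFDeriv_zero_eq_comp]
    exact (continuousMultilinearCurryFin0 ℝ E F).symm.toContinuousLinearEquiv.map_tsum
  | succ k ih =>
    intro x hx
    have hs : Summable fun i => iteratedFDeriv ℝ k (f i) x :=
      .of_norm_bounded (hv k) fun i => hb k i x hx
    have hd := hasFDerivAt_tsum_of_isPreconnected (hv (k + 1)) hU hUc
      (fun i y hy => hasFDerivAt_iteratedFDeriv hU (hf i) k hy)
      (fun i y hy => by
        rw [fderiv_iteratedFDeriv, Function.comp_apply, LinearIsometryEquiv.norm_map]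
        exact hb (k + 1) i y hy) hx hs hx
    have he : iteratedFDeriv ℝ k (fun y => ∑' i, f i y) =ᶠ[nhds x]
        fun y => ∑' i, iteratedFDeriv ℝ k (f i) y :=
      Filter.eventuallyEq_of_mem (hU.mem_nhds hx) ih
    simp_rw [iteratedFDeriv_succ_eq_comp_left, Function.comp_apply]
    rw [he.fderiv_eq, hd.fderiv]
    exact (continuousMultilinearCurryLeftEquiv ℝ
        (fun _ : Fin (k + 1) => E) F).symm.toContinuousLinearEquiv.map_tsum

theorem contDiffOn_tsum_of_isPreconnected (hU : IsOpen U) (hUc : IsPreconnected U)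
    (hf : ∀ i, ContDiffOn ℝ ∞ (f i) U) (hv : ∀ k, Summable (v k))
    (hb : ∀ k i, ∀ x ∈ U, ‖iteratedFDeriv ℝ k (f i) x‖ ≤ v k i) :
    ContDiffOn ℝ ∞ (fun y => ∑' i, f i y) U := by
  refine contDiffOn_of_differentiableOn fun k _ x hx => ?_
  have hs : Summable fun i => iteratedFDeriv ℝ k (f i) x :=
    .of_norm_bounded (hv k) fun i => hb k i x hx
  have hd := hasFDerivAt_tsum_of_isPreconnected (hv (k + 1)) hU hUc
    (fun i y hy => hasFDerivAt_iteratedFDeriv hU (hf i) k hy)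
    (fun i y hy => by
      rw [fderiv_iteratedFDeriv, Function.comp_apply, LinearIsometryEquiv.norm_map]
      exact hb (k + 1) i y hy) hx hs hx
  refine DifferentiableWithinAt.congr hd.differentiableAt.differentiableWithinAt (fun y hy => ?_) ?_
  · rw [iteratedFDerivWithin_of_isOpen k hU hy,
      iteratedFDeriv_tsum_of_isPreconnected hU hUc hf hv hb k y hy]
  · rw [iteratedFDerivWithin_of_isOpen k hU hx,
      iteratedFDeriv_tsum_of_isPreconnected hU hUc hf hv hb k x hx]

end Series

theorem laplacian_tsum_of_isPreconnected {ι E F : Type*} [NormedAddCommGroup E]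
    [InnerProductSpace ℝ E] [FiniteDimensional ℝ E] [NormedAddCommGroup F] [NormedSpace ℝ F]
    [CompleteSpace F] {f : ι → E → F} {v : ℕ → ι → ℝ} {U : Set E}
    (hU : IsOpen U) (hUc : IsPreconnected U)
    (hf : ∀ i, ContDiffOn ℝ ∞ (f i) U) (hv : ∀ k, Summable (v k))
    (hb : ∀ k i, ∀ x ∈ U, ‖iteratedFDeriv ℝ k (f i) x‖ ≤ v k i) {x : E} (hx : x ∈ U) :
    Δ (fun y => ∑' i, f i y) x = ∑' i, Δ (f i) x := by
  have hs : Summable fun i => iteratedFDeriv ℝ 2 (f i) x :=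
    .of_norm_bounded (hv 2) fun i => hb 2 i x hx
  have ha (w : Fin 2 → E) : HasSum (fun i => iteratedFDeriv ℝ 2 (f i) x w)
      ((∑' i, iteratedFDeriv ℝ 2 (f i) x) w) :=
    hs.hasSum.mapL (ContinuousMultilinearMap.apply ℝ (fun _ : Fin 2 => E) F w)
  simp_rw [InnerProductSpace.laplacian_eq_iteratedFDeriv_stdOrthonormalBasis]
  rw [Summable.tsum_finsetSum fun j _ => (ha _).summable]
  refine Finset.sum_congr rfl fun j _ => ?_
  rw [iteratedFDeriv_tsum_of_isPreconnected hU hUc hf hv hb 2 x hx, (ha _).tsum_eq]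

/-! ### Radial functions -/

section Radial

variable {E : Type*} [NormedAddCommGroup E] [InnerProductSpace ℝ E]

theorem hasFDerivAt_comp_norm_sq {f : ℝ → ℝ} {f' : ℝ} {x : E}
    (hf : HasDerivAt f f' (‖x‖ ^ 2)) :
    HasFDerivAt (fun y : E => f (‖y‖ ^ 2)) ((2 * f') • innerSL ℝ x) x := by
  have h := hf.comp_hasFDerivAt x (hasStrictFDerivAt_norm_sq x).hasFDerivAt
  have he : f' • 2 • innerSL ℝ x = (2 * f') • innerSL ℝ x := by
    ext v
    simp
    ring
  rw [← he]
  exact h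

/-- `Δ f(|x|²) = 4 |x|² f''(|x|²) + 2 n f'(|x|²)`. -/
theorem laplacian_comp_norm_sq [FiniteDimensional ℝ E] {f f' : ℝ → ℝ} {f'' : ℝ} {x : E}
    (hf : ∀ᶠ w in nhds (‖x‖ ^ 2), HasDerivAt f (f' w) w) (hf' : HasDerivAt f' f'' (‖x‖ ^ 2)) :
    Δ (fun y : E => f (‖y‖ ^ 2)) x =
      4 * ‖x‖ ^ 2 * f'' + 2 * Module.finrank ℝ E * f' (‖x‖ ^ 2) := by
  let B : E →L[ℝ] E →L[ℝ] ℝ := innerSL ℝ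
  have hB (v w : E) : B v w = inner ℝ v w := rfl
  have h1 : fderiv ℝ (fun y : E => f (‖y‖ ^ 2)) =ᶠ[nhds x] fun y => (2 * f' (‖y‖ ^ 2)) • B y := by
    have hc : ContinuousAt (fun y : E => ‖y‖ ^ 2) x := by fun_prop
    filter_upwards [hc.eventually hf] with y hy
    exact (hasFDerivAt_comp_norm_sq hy).fderiv
  have h2 : HasFDerivAt (fun y : E => (2 * f' (‖y‖ ^ 2)) • B y)
      ((2 * f' (‖x‖ ^ 2)) • B + ((2 : ℝ) • (2 * f'') • B x).smulRight (B x)) x :=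
    ((hasFDerivAt_comp_norm_sq hf').const_mul 2).smul B.hasFDerivAt
  rw [InnerProductSpace.laplacian_eq_iteratedFDeriv_stdOrthonormalBasis]
  have h3 : ∀ v : E, iteratedFDeriv ℝ 2 (fun y : E => f (‖y‖ ^ 2)) x ![v, v] =
      2 * f' (‖x‖ ^ 2) * ‖v‖ ^ 2 + 4 * f'' * inner ℝ x v ^ 2 := by
    intro v
    rw [iteratedFDeriv_two_apply, h1.fderiv_eq, h2.fderiv]
    simp [hB]
    ring
  simp_rw [h3]
  rw [Finset.sum_add_distrib, ← Finset.mul_sum, ← Finset.mul_sum]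
  have h4 := (stdOrthonormalBasis ℝ E).sum_sq_inner_right x
  simp only [real_inner_comm x] at h4
  simp only [OrthonormalBasis.norm_eq_one, h4]
  simp
  ring

end Radial

/-! ### The radial Bessel integrals -/

/-- The integrand `t^{-k} e^{-α²t² - w/(4t²)}` of `besselInt`. -/
noncomputable def besselKern (α : ℝ) (k : ℕ) (w t : ℝ) : ℝ :=
  t⁻¹ ^ k * Real.exp (-(α ^ 2 * t ^ 2) - w * t⁻¹ ^ 2 / 4)

/-- `J_k(w) = ∫_0^∞ t^{-k} e^{-α²t² - w/(4t²)} dt`. Up to a constant, `J_{n-1}(|x|²)` is the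
integral over time `s = t²` of the heat kernel damped by `e^{-α²s}`. -/
noncomputable def besselInt (α : ℝ) (k : ℕ) (w : ℝ) : ℝ := ∫ t in Set.Ioi 0, besselKern α k w t

theorem measurable_besselKern (α : ℝ) (k : ℕ) (w : ℝ) : Measurable (besselKern α k w) := by
  unfold besselKern
  fun_prop

theorem besselKern_nonneg (α : ℝ) (k : ℕ) (w : ℝ) {t : ℝ} (ht : 0 < t) :
    0 ≤ besselKern α k w t := by
  unfold besselKern
  positivity

theorem besselInt_nonneg (α : ℝ) (k : ℕ) (w : ℝ) : 0 ≤ besselInt α k w :=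
  setIntegral_nonneg measurableSet_Ioi fun _ ht => besselKern_nonneg α k w ht

theorem exists_pow_le_exp_sq {c : ℝ} (hc : 0 < c) (k : ℕ) :
    ∃ C, 0 ≤ C ∧ ∀ u : ℝ, 0 ≤ u → u ^ k ≤ C * Real.exp (c * u ^ 2) := by
  refine ⟨1 + k.factorial / c ^ k, by positivity, fun u hu => ?_⟩
  have h1 : (c * u ^ 2) ^ k / k.factorial ≤ Real.exp (c * u ^ 2) :=
    Real.pow_div_factorial_le_exp _ (by positivity) k
  have h2 : u ^ k ≤ 1 + (u ^ k) ^ 2 := by nlinarith [sq_nonneg (u ^ k - 1)]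
  have h3 : (u ^ k) ^ 2 = k.factorial / c ^ k * ((c * u ^ 2) ^ k / k.factorial) := by
    rw [mul_pow, ← pow_mul, ← pow_mul, mul_comm k 2]
    field_simp
  have h4 : 1 ≤ Real.exp (c * u ^ 2) := Real.one_le_exp (by positivity)
  have h5 : k.factorial / c ^ k * ((c * u ^ 2) ^ k / k.factorial) ≤
      k.factorial / c ^ k * Real.exp (c * u ^ 2) := by gcongr
  rw [add_mul, one_mul]
  linarith

theorem exists_one_add_pow_le_exp {c : ℝ} (hc : 0 < c) (p : ℕ) :
    ∃ C, 0 ≤ C ∧ ∀ r : ℝ, 0 ≤ r → (1 + r) ^ p ≤ C * Real.exp (c * r) := by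
  refine ⟨p.factorial / c ^ p * Real.exp c, by positivity, fun r hr => ?_⟩
  have h1 : (c * (1 + r)) ^ p / p.factorial ≤ Real.exp (c * (1 + r)) :=
    Real.pow_div_factorial_le_exp _ (by positivity) p
  have h3 : (1 + r) ^ p = p.factorial / c ^ p * ((c * (1 + r)) ^ p / p.factorial) := by
    rw [mul_pow]
    field_simp
  rw [h3, mul_assoc, ← Real.exp_add, show c + c * r = c * (1 + r) by ring]
  gcongr

/-- For `r ≥ δ > 0` the integrand at `w = r²` decays faster than any power of `r`, uniformly in `t`,
with a Gaussian in `t` to spare. -/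
theorem exists_besselKern_le {α δ : ℝ} (hα : 0 < α) (hδ : 0 < δ) (k p : ℕ) :
    ∃ C, 0 ≤ C ∧ ∀ r t : ℝ, δ ≤ r → 0 < t →
      besselKern α k (r ^ 2) t ≤ C * ((1 + r) ^ p)⁻¹ * Real.exp (-(α ^ 2 / 2) * t ^ 2) := by
  obtain ⟨C₁, hC₁, h₁⟩ := exists_pow_le_exp_sq (show 0 < δ ^ 2 / 8 by positivity) k
  obtain ⟨C₂, hC₂, h₂⟩ := exists_one_add_pow_le_exp (show 0 < α / 2 by positivity) p
  refine ⟨C₁ * C₂, by positivity, fun r t hr ht => ?_⟩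
  have hr0 : 0 < r := hδ.trans_le hr
  have h3 := h₁ t⁻¹ (by positivity)
  have h4 := h₂ r hr0.le
  have h4' : Real.exp (-(α / 2 * r)) ≤ C₂ * ((1 + r) ^ p)⁻¹ := by
    rw [Real.exp_neg, ← div_eq_mul_inv, le_div_iff₀ (by positivity),
      inv_mul_le_iff₀ (by positivity)]
    linarith
  -- the inequality of arithmetic and geometric means splits off the factor `e^{-αr/2}`
  have h5 : -(α ^ 2 * t ^ 2) - r ^ 2 * t⁻¹ ^ 2 / 4 ≤
      -(δ ^ 2 / 8 * t⁻¹ ^ 2) + -(α / 2 * r) + -(α ^ 2 / 2) * t ^ 2 := by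
    have e1 : t * t⁻¹ = 1 := mul_inv_cancel₀ ht.ne'
    have e2 : δ ^ 2 * t⁻¹ ^ 2 ≤ r ^ 2 * t⁻¹ ^ 2 := by gcongr
    have e3 : 0 ≤ (2 * α * t - r * t⁻¹) ^ 2 := sq_nonneg _
    have e4 : (2 * α * t - r * t⁻¹) ^ 2 =
      4 * (α ^ 2 * t ^ 2) - 4 * α * r * (t * t⁻¹) + r ^ 2 * t⁻¹ ^ 2 := by ring
    rw [e4, e1] at e3
    linarith
  calc besselKern α k (r ^ 2) t
      ≤ (C₁ * Real.exp (δ ^ 2 / 8 * t⁻¹ ^ 2)) *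
        Real.exp (-(δ ^ 2 / 8 * t⁻¹ ^ 2) + -(α / 2 * r) + -(α ^ 2 / 2) * t ^ 2) := by
        unfold besselKern
        gcongr
    _ = C₁ * Real.exp (-(α / 2 * r)) * Real.exp (-(α ^ 2 / 2) * t ^ 2) := by
        have e : Real.exp (δ ^ 2 / 8 * t⁻¹ ^ 2) * Real.exp (-(δ ^ 2 / 8 * t⁻¹ ^ 2)) = 1 := by
          rw [← Real.exp_add, add_neg_cancel, Real.exp_zero]
        rw [Real.exp_add, Real.exp_add]
        linear_combination (C₁ * Real.exp (-(α / 2 * r)) * Real.exp (-(α ^ 2 / 2) * t ^ 2)) * e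
    _ ≤ C₁ * C₂ * ((1 + r) ^ p)⁻¹ * Real.exp (-(α ^ 2 / 2) * t ^ 2) := by
        rw [mul_assoc C₁ C₂]
        gcongr

theorem integrableOn_exp_neg_mul_sq {α : ℝ} (hα : 0 < α) (C : ℝ) :
    IntegrableOn (fun t : ℝ => C * Real.exp (-(α ^ 2 / 2) * t ^ 2)) (Set.Ioi 0) :=
  ((integrable_exp_neg_mul_sq (show 0 < α ^ 2 / 2 by positivity)).const_mul C).integrableOn

theorem integrableOn_besselKern {α w : ℝ} (hα : 0 < α) (hw : 0 < w) (k : ℕ) :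
    IntegrableOn (besselKern α k w) (Set.Ioi 0) := by
  obtain ⟨C, -, h⟩ := exists_besselKern_le hα (Real.sqrt_pos.2 hw) k 0
  refine (integrableOn_exp_neg_mul_sq hα C).mono' (measurable_besselKern α k w).aestronglyMeasurable
    ((ae_restrict_iff' measurableSet_Ioi).2 (.of_forall fun t ht => ?_))
  rw [Real.norm_of_nonneg (besselKern_nonneg α k w ht)]
  simpa [Real.sq_sqrt hw.le] using h (√w) t le_rfl ht

theorem exists_besselInt_le {α δ : ℝ} (hα : 0 < α) (hδ : 0 < δ) (k p : ℕ) :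
    ∃ C, 0 ≤ C ∧ ∀ r : ℝ, δ ≤ r → besselInt α k (r ^ 2) ≤ C * ((1 + r) ^ p)⁻¹ := by
  obtain ⟨C, hC, h⟩ := exists_besselKern_le hα hδ k p
  refine ⟨C * ∫ t in Set.Ioi (0 : ℝ), Real.exp (-(α ^ 2 / 2) * t ^ 2),
    mul_nonneg hC (integral_nonneg fun t => (Real.exp_pos _).le), fun r hr => ?_⟩
  rw [mul_right_comm, ← integral_const_mul]
  exact setIntegral_mono_on (integrableOn_besselKern hα (by have := hδ.trans_le hr; positivity) k)
    (integrableOn_exp_neg_mul_sq hα _) measurableSet_Ioi fun t ht => h r t hr ht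

theorem hasDerivAt_besselInt {α w : ℝ} (hα : 0 < α) (hw : 0 < w) (k : ℕ) :
    HasDerivAt (besselInt α k) (-(1 / 4) * besselInt α (k + 2) w) w := by
  obtain ⟨C, -, h⟩ := exists_besselKern_le hα (Real.sqrt_pos.2 (half_pos hw)) (k + 2) 0
  have hd := hasDerivAt_integral_of_dominated_loc_of_deriv_le (μ := volume.restrict (Set.Ioi 0))
    (F := besselKern α k) (F' := fun w t => -(1 / 4) * besselKern α (k + 2) w t)
    (bound := fun t => C * Real.exp (-(α ^ 2 / 2) * t ^ 2)) (Ioi_mem_nhds (half_lt_self hw))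
    (.of_forall fun v => (measurable_besselKern α k v).aestronglyMeasurable)
    (integrableOn_besselKern hα hw k)
    ((measurable_besselKern α (k + 2) w).const_mul _).aestronglyMeasurable
    ((ae_restrict_iff' measurableSet_Ioi).2 (.of_forall fun t ht v hv => ?_))
    (integrableOn_exp_neg_mul_sq hα C) (.of_forall fun t v _ => ?_)
  · rw [integral_const_mul] at hd
    exact hd.2
  · have hv0 : 0 ≤ v := (half_pos hw).le.trans (le_of_lt hv)
    have h1 := h (√v) t (Real.sqrt_le_sqrt (le_of_lt hv)) ht
    rw [Real.sq_sqrt hv0, pow_zero, inv_one, mul_one] at h1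
    have h2 := besselKern_nonneg α (k + 2) v ht
    rw [norm_mul, Real.norm_of_nonneg h2]
    rw [show ‖(-(1 / 4) : ℝ)‖ = 1 / 4 by norm_num]
    linarith
  · have h1 : HasDerivAt (fun v => -(α ^ 2 * t ^ 2) - v * t⁻¹ ^ 2 / 4) (-(1 * t⁻¹ ^ 2 / 4)) v :=
      (((hasDerivAt_id v).mul_const _).div_const 4).const_sub _
    refine HasDerivAt.congr_deriv (h1.exp.const_mul (t⁻¹ ^ k)) ?_
    simp only [besselKern]
    ring

theorem contDiffOn_besselInt {α : ℝ} (hα : 0 < α) (k : ℕ) :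
    ContDiffOn ℝ ∞ (besselInt α k) (Set.Ioi 0) := by
  have h : ∀ (m k : ℕ), ContDiffOn ℝ m (besselInt α k) (Set.Ioi 0) := by
    intro m
    induction m with
    | zero =>
      intro k
      exact contDiffOn_zero.2 fun w hw =>
        (hasDerivAt_besselInt hα hw k).continuousAt.continuousWithinAt
    | succ m ih =>
      intro k
      push_cast
      rw [contDiffOn_succ_iff_deriv_of_isOpen isOpen_Ioi]
      refine ⟨fun w hw => (hasDerivAt_besselInt hα hw k).differentiableAt.differentiableWithinAt,
        by simp, (contDiffOn_const.mul (ih (k + 2))).congr fun w hw =>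
          (hasDerivAt_besselInt hα hw k).deriv⟩
  exact contDiffOn_infty.2 fun m => h m k

theorem norm_iteratedFDeriv_besselInt {α w : ℝ} (hα : 0 < α) (hw : 0 < w) (k m : ℕ) :
    ‖iteratedFDeriv ℝ m (besselInt α k) w‖ = (1 / 4) ^ m * besselInt α (k + 2 * m) w := by
  have h : ∀ m : ℕ, ∀ v ∈ Set.Ioi (0 : ℝ),
      iteratedDeriv m (besselInt α k) v = (-(1 / 4)) ^ m * besselInt α (k + 2 * m) v := by
    intro m
    induction m with
    | zero => simp
    | succ m ih =>
      intro v hv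
      have he : iteratedDeriv m (besselInt α k) =ᶠ[nhds v]
          fun v => (-(1 / 4)) ^ m * besselInt α (k + 2 * m) v :=
        Filter.eventuallyEq_of_mem (Ioi_mem_nhds hv) ih
      rw [iteratedDeriv_succ, he.deriv_eq, ((hasDerivAt_besselInt hα hv _).const_mul _).deriv]
      ring_nf
  rw [norm_iteratedFDeriv_eq_norm_iteratedDeriv, h m w hw, norm_mul,
    Real.norm_of_nonneg (besselInt_nonneg _ _ _)]
  simp

/-- Integration of the derivative of `t^{-(k+1)} e^{-α²t² - w/(4t²)}` over `(0, ∞)`. This is the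
identity that makes `J_k(|x|²)` a solution of the Klein-Gordon equation in dimension `k + 1`. -/
theorem besselInt_recurrence {α w : ℝ} (hα : 0 < α) (hw : 0 < w) (k : ℕ) :
    w / 2 * besselInt α (k + 4) w =
      (k + 1) * besselInt α (k + 2) w + 2 * α ^ 2 * besselInt α k w := by
  have hd : ∀ t ∈ Set.Ioi (0 : ℝ), HasDerivAt (besselKern α (k + 1) w)
      (w / 2 * besselKern α (k + 4) w t - (k + 1) * besselKern α (k + 2) w t
        - 2 * α ^ 2 * besselKern α k w t) t := by
    intro t ht
    have ht0 : t ≠ 0 := (ne_of_gt ht)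
    have h1 := hasDerivAt_inv ht0
    have h2 : HasDerivAt (fun t : ℝ => -(α ^ 2 * t ^ 2) - w * t⁻¹ ^ 2 / 4) _ t :=
      ((((hasDerivAt_id t).fun_pow 2).const_mul (α ^ 2)).fun_neg).fun_sub
        (((h1.fun_pow 2).const_mul w).div_const 4)
    have h3 := (h1.fun_pow (k + 1)).fun_mul h2.exp
    refine HasDerivAt.congr_deriv h3 ?_
    simp only [besselKern]
    have e : t * t⁻¹ = 1 := mul_inv_cancel₀ ht0
    have e2 : (t ^ 2)⁻¹ = t⁻¹ ^ 2 := by rw [inv_pow]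
    rw [e2]
    push_cast
    rw [id_eq]
    generalize Real.exp _ = X
    generalize t⁻¹ = u at *
    linear_combination (-2 * α ^ 2 * u ^ k * X) * e
  have hint : ∀ j, IntegrableOn (besselKern α j w) (Set.Ioi 0) := integrableOn_besselKern hα hw
  have hi := (((hint (k + 4)).const_mul (w / 2)).sub ((hint (k + 2)).const_mul (k + 1))).sub
    ((hint k).const_mul (2 * α ^ 2))
  -- at `t = 0` the kernel takes the junk value `0`, which is also its limit from the right
  have hlim0 : ContinuousWithinAt (besselKern α (k + 1) w) (Set.Ici 0) 0 := by
    obtain ⟨C, hC, h⟩ := exists_besselKern_le hα (Real.sqrt_pos.2 hw) (k + 2) 0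
    have hb : ∀ t ∈ Set.Ici (0 : ℝ), ‖besselKern α (k + 1) w t‖ ≤ C * t := by
      intro t ht
      rcases (Set.mem_Ici.1 ht).eq_or_lt with rfl | ht
      · simp [besselKern]
      rw [Real.norm_of_nonneg (besselKern_nonneg _ _ _ ht)]
      have h1 := h (√w) t le_rfl ht
      rw [Real.sq_sqrt hw.le, pow_zero, inv_one, mul_one] at h1
      have h2 : besselKern α (k + 1) w t = t * besselKern α (k + 2) w t := by
        simp only [besselKern]
        have e : t * t⁻¹ = 1 := mul_inv_cancel₀ ht.ne'
        rw [pow_succ _ (k + 1)]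
        linear_combination (-t⁻¹ ^ (k + 1) * Real.exp (-(α ^ 2 * t ^ 2) - w * t⁻¹ ^ 2 / 4)) * e
      have h3 : Real.exp (-(α ^ 2 / 2) * t ^ 2) ≤ 1 :=
        Real.exp_le_one_iff.2 (by nlinarith [sq_nonneg (α * t)])
      rw [h2, mul_comm]
      gcongr
      exact h1.trans (by nlinarith)
    have h0 : besselKern α (k + 1) w 0 = 0 := by simp [besselKern]
    rw [ContinuousWithinAt, h0]
    refine squeeze_zero_norm' (Filter.eventually_of_mem self_mem_nhdsWithin hb) ?_
    have : Filter.Tendsto (fun t : ℝ => C * t) (nhds 0) (nhds (C * 0)) := by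
      exact (continuous_const.mul continuous_id).tendsto 0
    rw [mul_zero] at this
    exact this.mono_left nhdsWithin_le_nhds
  have hlim : Filter.Tendsto (besselKern α (k + 1) w) Filter.atTop (nhds 0) := by
    obtain ⟨C, hC, h⟩ := exists_besselKern_le hα (Real.sqrt_pos.2 hw) (k + 1) 0
    refine squeeze_zero_norm' (a := fun t => C * Real.exp (-(α ^ 2 / 2) * t ^ 2))
      (Filter.eventually_of_mem (Filter.Ioi_mem_atTop 0) fun t ht => ?_) ?_
    · rw [Real.norm_of_nonneg (besselKern_nonneg _ _ _ ht)]
      simpa [Real.sq_sqrt hw.le] using h (√w) t le_rfl ht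
    · rw [← mul_zero C]
      refine Filter.Tendsto.const_mul C (Real.tendsto_exp_atBot.comp ?_)
      exact (Filter.tendsto_pow_atTop two_ne_zero).const_mul_atTop_of_neg
        (by have : 0 < α ^ 2 := by positivity
            linarith)
  have h := integral_Ioi_of_hasDerivAt_of_tendsto hlim0 hd hi hlim
  have hJ : ∀ j, ∫ t in Set.Ioi 0, besselKern α j w t = besselInt α j w := fun j => rfl
  have h0 : besselKern α (k + 1) w 0 = 0 := by simp [besselKern]
  rw [h0, integral_sub, integral_sub, integral_const_mul, integral_const_mul, integral_const_mul,
    hJ, hJ, hJ] at h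
  · linarith
  · exact (hint (k + 4)).const_mul (w / 2)
  · exact (hint (k + 2)).const_mul _
  · exact ((hint (k + 4)).const_mul (w / 2)).sub ((hint (k + 2)).const_mul _)
  · exact (hint k).const_mul _

/-! ### The Euclidean kernel as a heat integral -/

/-- The substitution `t² = (r/2α) e^τ` in `J_k(r²)`, after which the exponent is `-αr cosh τ`. -/
theorem besselInt_sq_eq_integral_cosh {α r : ℝ} (hα : 0 < α) (hr : 0 < r) (k : ℕ) :
    ∫ τ : ℝ, Real.exp (-(α * r * Real.cosh τ) - (((k + 1 : ℕ) : ℝ) / 2 - 1) * τ) =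
      2 * (r / (2 * α)) ^ (((k + 1 : ℕ) : ℝ) / 2 - 1) * besselInt α k (r ^ 2) := by
  set a : ℝ := r / (2 * α) with ha
  have ha0 : 0 < a := by positivity
  set f : ℝ → ℝ := fun τ => √a * Real.exp (τ / 2) with hf
  have hf0 (τ : ℝ) : 0 < f τ := mul_pos (Real.sqrt_pos.2 ha0) (Real.exp_pos _)
  have himg : f '' Set.univ = Set.Ioi 0 := by
    ext t
    refine ⟨?_, fun ht => ⟨2 * Real.log (t / √a), trivial, ?_⟩⟩
    · rintro ⟨τ, -, rfl⟩
      exact hf0 τ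
    · have hs := Real.sqrt_pos.2 ha0
      simp only [hf]
      rw [mul_div_cancel_left₀ _ two_ne_zero, Real.exp_log (div_pos ht hs)]
      field_simp
  have hinj : Set.InjOn f Set.univ := by
    intro x _ y _ h
    have h2 := mul_left_cancel₀ (Real.sqrt_pos.2 ha0).ne' h
    linarith [Real.exp_injective h2]
  have hd (τ : ℝ) : HasDerivAt f (f τ / 2) τ := by
    refine HasDerivAt.congr_deriv ((((hasDerivAt_id τ).div_const 2).exp).const_mul (√a)) ?_
    simp [hf]
    ring
  have h := integral_image_eq_integral_abs_deriv_smul MeasurableSet.univ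
    (fun τ _ => (hd τ).hasDerivWithinAt) hinj (besselKern α k (r ^ 2))
  rw [himg, setIntegral_univ] at h
  rw [besselInt, h, ← integral_const_mul]
  congr 1
  funext τ
  have hsq : f τ ^ 2 = a * Real.exp τ := by
    simp only [hf]
    rw [mul_pow, Real.sq_sqrt ha0.le, ← Real.exp_nat_mul]
    congr 2
    push_cast
    ring
  have hexp : -(α ^ 2 * f τ ^ 2) - r ^ 2 * (f τ)⁻¹ ^ 2 / 4 = -(α * r * Real.cosh τ) := by
    rw [inv_pow, hsq, mul_inv, ← Real.exp_neg, Real.cosh_eq, ha]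
    field_simp
    ring
  have hpow : (f τ)⁻¹ ^ k * f τ =
      a ^ (-(((k + 1 : ℕ) : ℝ) / 2 - 1)) * Real.exp (-((((k + 1 : ℕ) : ℝ) / 2 - 1) * τ)) := by
    have e1 : Real.exp (-((((k + 1 : ℕ) : ℝ) / 2 - 1) * τ)) =
        Real.exp τ ^ (-(((k + 1 : ℕ) : ℝ) / 2 - 1)) := by
      rw [← Real.exp_mul]
      ring_nf
    rw [e1, ← Real.mul_rpow ha0.le (Real.exp_pos τ).le, ← hsq, ← Real.rpow_natCast (f τ) 2,
      ← Real.rpow_mul (hf0 τ).le, inv_pow, ← Real.rpow_natCast, ← Real.rpow_neg (hf0 τ).le]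
    nth_rewrite 2 [← Real.rpow_one (f τ)]
    rw [← Real.rpow_add (hf0 τ)]
    congr 1
    push_cast
    ring
  rw [abs_of_pos (half_pos (hf0 τ)), smul_eq_mul, besselKern, hexp, sub_eq_add_neg, Real.exp_add]
  have e2 : a ^ (((k + 1 : ℕ) : ℝ) / 2 - 1) * a ^ (-(((k + 1 : ℕ) : ℝ) / 2 - 1)) = 1 := by
    rw [← Real.rpow_add ha0, add_neg_cancel, Real.rpow_zero]
  generalize Real.exp (-(α * r * Real.cosh τ)) = X at *
  linear_combination (-a ^ (((k + 1 : ℕ) : ℝ) / 2 - 1) * X) * hpow -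
    (Real.exp (-((((k + 1 : ℕ) : ℝ) / 2 - 1) * τ)) * X) * e2

theorem sphereArea_mul_Gamma {n : ℕ} (hn : 1 ≤ n) :
    sphereArea n * Real.Gamma ((n : ℝ) / 2) = 2 * Real.pi ^ ((n : ℝ) / 2) := by
  have hn0 : (0 : ℝ) < n := by exact_mod_cast hn
  have : Nonempty (Fin n) := ⟨⟨0, hn⟩⟩
  have hG : 0 < Real.Gamma ((n : ℝ) / 2) := Real.Gamma_pos_of_pos (by positivity)
  rw [sphereArea, Measure.real, Measure.toSphere_apply_univ, EuclideanSpace.volume_ball]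
  simp only [ENNReal.toReal_mul, finrank_euclideanSpace, Fintype.card_fin, ENNReal.toReal_natCast,
    ENNReal.ofReal_one, one_pow, one_mul]
  rw [ENNReal.toReal_ofReal (by positivity), Real.Gamma_add_one (by positivity),
    Real.sqrt_eq_rpow, ← Real.rpow_natCast, ← Real.rpow_mul Real.pi_pos.le,
    show 1 / 2 * (n : ℝ) = n / 2 by ring]
  field_simp

/-- The constant `-2 (4π)^{-n/2}` in front of the heat integral. -/
noncomputable def heatConst (n : ℕ) : ℝ := -(2 * ((4 * Real.pi) ^ ((n : ℝ) / 2))⁻¹)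

theorem euclidKernel_eq {n : ℕ} (hn : 1 ≤ n) {α : ℝ} (hα : 0 < α) {x : Euc n} (hx : x ≠ 0) :
    euclidKernel n α x = ((heatConst n * besselInt α (n - 1) (‖x‖ ^ 2) : ℝ) : ℂ) := by
  have hr : 0 < ‖x‖ := norm_pos_iff.2 hx
  set r := ‖x‖ with hrdef
  set ν : ℝ := (n : ℝ) / 2 - 1 with hν
  have hH : ∫ t : ℝ, Complex.exp (Complex.I * (Complex.I * α * r) * Real.cosh t - ν * t) =
      ((2 * (r / (2 * α)) ^ ν * besselInt α (n - 1) (r ^ 2) : ℝ) : ℂ) := by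
    have h := besselInt_sq_eq_integral_cosh hα hr (n - 1)
    rw [Nat.sub_add_cancel hn] at h
    rw [hν, ← h, ← integral_complex_ofReal]
    congr 1
    funext t
    push_cast
    congr 1
    linear_combination (α * r * Complex.cosh t) * Complex.I_mul_I
  have hlog : Complex.log ((1 / 2 : ℂ) * Complex.I * α) =
      ((Real.log (α / 2) : ℝ) : ℂ) + Real.pi / 2 * Complex.I := by
    rw [show (1 / 2 : ℂ) * Complex.I * α = ((α / 2 : ℝ) : ℂ) * Complex.I by push_cast; ring,
      Complex.log_ofReal_mul (by positivity) Complex.I_ne_zero, Complex.log_I]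
  have hpow : ((1 / 2 : ℂ) * Complex.I * α) ^ ((n : ℂ) / 2 - 1) =
      (((α / 2) ^ ν : ℝ) : ℂ) * Complex.exp (ν * Real.pi * Complex.I / 2) := by
    have h0 : (1 / 2 : ℂ) * Complex.I * α ≠ 0 := by
      simp [hα.ne']
    rw [Complex.cpow_def_of_ne_zero h0, hlog, add_mul, Complex.exp_add,
      Real.rpow_def_of_pos (by positivity), hν]
    push_cast
    congr 2
    ring
  have hexp : Complex.exp (ν * Real.pi * Complex.I / 2) *
      Complex.exp (-(ν * Real.pi * Complex.I / 2)) = 1 := by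
    rw [← Complex.exp_add, add_neg_cancel, Complex.exp_zero]
  have hreal : (α / 2) ^ ν * r ^ (1 - (n : ℝ) / 2) * (r / (2 * α)) ^ ν =
      4 * ((4 : ℝ) ^ ((n : ℝ) / 2))⁻¹ := by
    have e1 : r ^ (1 - (n : ℝ) / 2) = (r ^ ν)⁻¹ := by
      rw [← Real.rpow_neg hr.le, hν]
      ring_nf
    rw [e1, ← Real.inv_rpow hr.le, ← Real.mul_rpow (by positivity) (by positivity),
      ← Real.mul_rpow (by positivity) (by positivity),
      show α / 2 * r⁻¹ * (r / (2 * α)) = 4⁻¹ by field_simp; norm_num,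
      Real.inv_rpow (by norm_num), hν, Real.rpow_sub_one (by norm_num)]
    field_simp
  have hω : ((sphereArea n : ℝ) : ℂ) * (Real.Gamma ((n : ℝ) / 2) : ℂ) =
      ((2 * Real.pi ^ ((n : ℝ) / 2) : ℝ) : ℂ) := by
    rw [← sphereArea_mul_Gamma hn]
    push_cast
    rfl
  have hπn : 0 < Real.pi ^ ((n : ℝ) / 2) := by positivity
  have hconst : heatConst n = -(1 / (2 * Real.pi ^ ((n : ℝ) / 2))) *
      (4 * ((4 : ℝ) ^ ((n : ℝ) / 2))⁻¹) := by
    rw [heatConst, Real.mul_rpow (by norm_num) Real.pi_pos.le]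
    field_simp
    norm_num
  rw [euclidKernel, hankelOne, ← hrdef, hH, hpow, mul_assoc 2, hω, hconst, ← hreal]
  have hπ : (Real.pi : ℂ) ≠ 0 := by exact_mod_cast Real.pi_ne_zero
  have hπn' : ((Real.pi ^ ((n : ℝ) / 2) : ℝ) : ℂ) ≠ 0 := by exact_mod_cast hπn.ne'
  generalize Complex.exp (ν * Real.pi * Complex.I / 2) = A at *
  generalize Complex.exp (-(ν * Real.pi * Complex.I / 2)) = B at *
  push_cast
  generalize ((Real.pi ^ ((n : ℝ) / 2) : ℝ) : ℂ) = P at *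
  generalize ((r ^ (1 - (n : ℝ) / 2) : ℝ) : ℂ) = R
  generalize (((α / 2) ^ ν : ℝ) : ℂ) = S
  generalize (((r / (2 * α)) ^ ν : ℝ) : ℂ) = T
  generalize ((besselInt α (n - 1) (r ^ 2) : ℝ) : ℂ) = J
  have hI := Complex.I_ne_zero
  generalize Complex.I = I at *
  field_simp
  linear_combination (-(S * R * T * J)) * hexp

/-! ### Geometry of the maps `kleinMap m` -/

theorem kleinMap_eq_reflectIso {n : ℕ} (m : Fin n → ℤ) (x : Euc n) :
    kleinMap m x = reflectIso m x + latticeVec m := by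
  rw [kleinMap, reflectIso_apply]

theorem isometry_kleinMap {n : ℕ} (m : Fin n → ℤ) : Isometry (kleinMap m) := by
  refine Isometry.of_dist_eq fun x y => ?_
  rw [kleinMap_eq_reflectIso, kleinMap_eq_reflectIso, dist_add_right, LinearIsometryEquiv.dist_map]

theorem kleinMap_latticeVec_kleinInv {n : ℕ} (m : Fin n → ℤ) :
    kleinMap m (latticeVec (kleinInv m)) = 0 := by
  ext i
  have h : (lastSign m i : ℝ) * lastSign m i = 1 := by exact_mod_cast lastSign_mul_self m i
  simp only [kleinMap, reflectLast, latticeVec, kleinInv, PiLp.add_apply, PiLp.zero_apply]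
  push_cast
  linear_combination (-(m i : ℝ)) * h

theorem norm_kleinMap {n : ℕ} (m : Fin n → ℤ) (x : Euc n) :
    ‖kleinMap m x‖ = dist x (latticeVec (kleinInv m)) := by
  rw [← (isometry_kleinMap m).dist_eq, kleinMap_latticeVec_kleinInv, dist_zero_right]

theorem norm_latticeVec_le {n : ℕ} (m : Fin n → ℤ) (x : Euc n) :
    ‖latticeVec m‖ ≤ ‖kleinMap m x‖ + ‖x‖ := by
  have h := norm_sub_le (kleinMap m x) (reflectIso m x)
  rwa [kleinMap_eq_reflectIso, add_sub_cancel_left, LinearIsometryEquiv.norm_map,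
    ← kleinMap_eq_reflectIso] at h

theorem norm_kleinMap_le {n : ℕ} (m : Fin n → ℤ) (x : Euc n) :
    ‖kleinMap m x‖ ≤ ‖x‖ + ‖latticeVec m‖ := by
  rw [kleinMap_eq_reflectIso, ← LinearIsometryEquiv.norm_map (reflectIso m) x]
  exact norm_add_le _ _

theorem kleinMap_ne_zero {n : ℕ} {x : Euc n} (hx : x ∉ lattice n) (m : Fin n → ℤ) :
    kleinMap m x ≠ 0 := by
  intro h
  rw [← norm_eq_zero, norm_kleinMap, dist_eq_zero] at h
  exact hx ⟨_, h.symm⟩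

theorem isClosed_lattice (n : ℕ) : IsClosed (lattice n) := by
  have h : lattice n = ⋂ i : Fin n, {x : Euc n | x i ∈ Set.range ((↑) : ℤ → ℝ)} := by
    ext x
    simp only [lattice, Set.mem_range, Set.mem_iInter, Set.mem_ofPred_eq]
    constructor
    · rintro ⟨m, rfl⟩ i
      exact ⟨m i, rfl⟩
    · intro h
      choose m hm using h
      exact ⟨m, by ext i; exact hm i⟩
  rw [h]
  refine isClosed_iInter fun i => ?_
  exact Int.isClosedEmbedding_coe_real.isClosed_range.preimage (by fun_prop)

theorem countable_lattice (n : ℕ) : (lattice n).Countable := Set.countable_range _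

/-- The translates of a compact set that avoids the lattice stay away from the origin. -/
theorem exists_le_norm_kleinMap {n : ℕ} {C : Set (Euc n)} (hC : IsCompact C)
    (hd : Disjoint C (lattice n)) :
    ∃ δ : ℝ, 0 < δ ∧ ∀ x ∈ C, ∀ m : Fin n → ℤ, δ ≤ ‖kleinMap m x‖ := by
  obtain ⟨r, hr, h⟩ := Metric.exists_pos_forall_lt_edist hC (isClosed_lattice n) hd
  refine ⟨r, hr, fun x hx m => ?_⟩
  have h1 := h x hx (latticeVec (kleinInv m)) ⟨_, rfl⟩
  rw [edist_nndist, ENNReal.coe_lt_coe] at h1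
  rw [norm_kleinMap, dist_nndist]
  exact_mod_cast h1.le

/-! ### The images of the cell tile space -/

theorem measurePreserving_kleinMap {n : ℕ} (m : Fin n → ℤ) :
    MeasurePreserving (kleinMap m) (volume : Measure (Euc n)) volume := by
  have h := (measurePreserving_add_right (volume : Measure (Euc n)) (latticeVec m)).comp
    (reflectIso m).measurePreserving
  rwa [show (fun x => x + latticeVec m) ∘ reflectIso m = kleinMap m from
    funext fun x => (kleinMap_eq_reflectIso m x).symm] at h

theorem measurableEmbedding_kleinMap {n : ℕ} (m : Fin n → ℤ) :
    MeasurableEmbedding (kleinMap m) :=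
  (isometry_kleinMap m).isClosedEmbedding.measurableEmbedding

/-- The half-open cube of side one centred at a lattice point. -/
def latticeCube {n : ℕ} (m : Fin n → ℤ) : Set (Euc n) :=
  {x | ∀ i, x i ∈ Set.Ico ((m i : ℝ) - 1 / 2) (m i + 1 / 2)}

theorem measurableSet_latticeCube {n : ℕ} (m : Fin n → ℤ) : MeasurableSet (latticeCube m) := by
  have h : latticeCube m =
      ⋂ i, (fun x : Euc n => x i) ⁻¹' Set.Ico ((m i : ℝ) - 1 / 2) (m i + 1 / 2) := by
    ext x
    simp [latticeCube]
  rw [h]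
  exact MeasurableSet.iInter fun i => measurableSet_Ico.preimage (by fun_prop)

theorem mem_latticeCube_iff {n : ℕ} {m : Fin n → ℤ} {x : Euc n} :
    x ∈ latticeCube m ↔ ∀ i, m i = ⌊x i + 1 / 2⌋ := by
  refine forall_congr' fun i => ?_
  rw [eq_comm, Int.floor_eq_iff, Set.mem_Ico]
  constructor <;> rintro ⟨h1, h2⟩ <;> constructor <;> linarith

theorem iUnion_latticeCube (n : ℕ) : ⋃ m : Fin n → ℤ, latticeCube m = Set.univ :=
  Set.eq_univ_of_forall fun _ => Set.mem_iUnion.2 ⟨_, mem_latticeCube_iff.2 fun _ => rfl⟩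

theorem pairwise_disjoint_latticeCube (n : ℕ) :
    Pairwise (Function.onFun Disjoint (latticeCube (n := n))) := by
  intro m k hmk
  refine Set.disjoint_left.2 fun x h1 h2 => hmk ?_
  funext i
  rw [mem_latticeCube_iff.1 h1 i, mem_latticeCube_iff.1 h2 i]

/-- Up to a null set, `kleinMap m` takes the cell to the unit cube centred at `m`: the reflection
preserves the symmetric cell. -/
theorem preimage_latticeCube_ae_eq {n : ℕ} (m : Fin n → ℤ) :
    kleinMap m ⁻¹' latticeCube m =ᵐ[volume] kleinCell n := by
  have h1 : latticeCube m =ᵐ[volume]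
      {x : Euc n | ∀ i, x i ∈ Set.Icc ((m i : ℝ) - 1 / 2) (m i + 1 / 2)} := by
    have h := (PiLp.volume_preserving_ofLp (Fin n)).quasiMeasurePreserving.preimage_ae_eq
      (Measure.univ_pi_Ico_ae_eq_Icc (μ := fun _ : Fin n => (volume : Measure ℝ))
        (f := fun i => (m i : ℝ) - 1 / 2) (g := fun i => (m i : ℝ) + 1 / 2))
    have e1 : (WithLp.ofLp ⁻¹' Set.univ.pi fun i => Set.Ico ((m i : ℝ) - 1 / 2) (m i + 1 / 2) :
        Set (Euc n)) = latticeCube m := by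
      ext x
      simp [latticeCube]
    have e2 : (WithLp.ofLp ⁻¹' Set.Icc (fun i => (m i : ℝ) - 1 / 2) (fun i => (m i : ℝ) + 1 / 2) :
        Set (Euc n)) = {x | ∀ i, x i ∈ Set.Icc ((m i : ℝ) - 1 / 2) (m i + 1 / 2)} := by
      ext x
      simp [Pi.le_def, forall_and]
    rwa [e1, e2] at h
  have h2 := (measurePreserving_kleinMap m).quasiMeasurePreserving.preimage_ae_eq h1
  refine h2.trans (Filter.Eventually.of_forall fun x => propext ?_)
  change (∀ i, kleinMap m x i ∈ _) ↔ ∀ i, x i ∈ _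
  refine forall_congr' fun i => ?_
  simp only [kleinMap, reflectLast, latticeVec, PiLp.add_apply, Set.mem_Icc]
  rcases lastSign_cases m i with h | h <;> rw [h] <;> push_cast <;> constructor <;>
    rintro ⟨h1, h2⟩ <;> constructor <;> linarith

theorem setIntegral_kleinCell_comp {n : ℕ} {V : Type*} [NormedAddCommGroup V] [NormedSpace ℝ V]
    (f : Euc n → V) (m : Fin n → ℤ) :
    ∫ x in kleinCell n, f (kleinMap m x) = ∫ x in latticeCube m, f x := by
  rw [← setIntegral_congr_set (preimage_latticeCube_ae_eq m)]
  exact (measurePreserving_kleinMap m).setIntegral_preimage_emb (measurableEmbedding_kleinMap m) _ _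

theorem hasSum_setIntegral_kleinCell {n : ℕ} {V : Type*} [NormedAddCommGroup V] [NormedSpace ℝ V]
    {f : Euc n → V} (hf : Integrable f) :
    HasSum (fun m : Fin n → ℤ => ∫ x in kleinCell n, f (kleinMap m x)) (∫ x, f x) := by
  simp_rw [setIntegral_kleinCell_comp]
  have h := hasSum_integral_iUnion (f := f) (μ := volume) (measurableSet_latticeCube (n := n))
    (pairwise_disjoint_latticeCube n) hf.integrableOn
  rwa [iUnion_latticeCube, setIntegral_univ] at h

theorem volume_real_kleinCell (n : ℕ) : volume.real (kleinCell n) = 1 := by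
  have h : kleinCell n = (fun x : Euc n => (x.ofLp : Fin n → ℝ)) ⁻¹'
      Set.Icc (fun _ => (-1 / 2 : ℝ)) (fun _ => 1 / 2) := by
    ext x
    simp [kleinCell, Pi.le_def, forall_and]
  rw [h, Measure.real, (PiLp.volume_preserving_ofLp (Fin n)).measure_preimage
    measurableSet_Icc.nullMeasurableSet, Real.volume_Icc_pi]
  norm_num

theorem measurableSet_kleinCell (n : ℕ) : MeasurableSet (kleinCell n) := by
  have h : kleinCell n = ⋂ i, (fun x : Euc n => x i) ⁻¹' Set.Icc (-1 / 2) (1 / 2) := by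
    ext x
    simp [kleinCell]
  rw [h]
  exact MeasurableSet.iInter fun i => measurableSet_Icc.preimage (by fun_prop)

theorem norm_le_of_mem_kleinCell {n : ℕ} {x : Euc n} (hx : x ∈ kleinCell n) : ‖x‖ ≤ n := by
  rw [EuclideanSpace.norm_eq]
  refine Real.sqrt_le_iff.2 ⟨by positivity, ?_⟩
  have h : ∀ i ∈ Finset.univ, ‖x i‖ ^ 2 ≤ 1 := by
    intro i _
    have := hx i
    rw [Real.norm_eq_abs, sq_abs]
    nlinarith [this.1, this.2]
  calc ∑ i, ‖x i‖ ^ 2 ≤ ∑ _i : Fin n, (1 : ℝ) := Finset.sum_le_sum h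
    _ = n := by simp
    _ ≤ (n : ℝ) ^ 2 := by exact_mod_cast Nat.le_self_pow two_ne_zero n

theorem inv_one_add_norm_kleinMap_le {n : ℕ} (p : ℕ) {R : ℝ} {x : Euc n} (hx : ‖x‖ ≤ R)
    (m : Fin n → ℤ) :
    ((1 + ‖kleinMap m x‖) ^ p)⁻¹ ≤ (1 + R) ^ p * ((1 + ‖latticeVec m‖) ^ p)⁻¹ := by
  have h := norm_latticeVec_le m x
  have hR : 0 ≤ R := (norm_nonneg x).trans hx
  rw [← div_eq_mul_inv, inv_le_comm₀ (by positivity) (by positivity), inv_div, ← div_pow]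
  refine pow_le_pow_left₀ (by positivity) ?_ p
  rw [div_le_iff₀ (by positivity)]
  nlinarith [norm_nonneg (kleinMap m x)]

/-- The lattice sum of `(1 + |m|)^{-(n+1)}` is compared with the integral of
`(1 + |x|)^{-(n+1)}` over the tiling by unit cubes. -/
theorem summable_inv_one_add_norm_latticeVec (n : ℕ) :
    Summable fun m : Fin n → ℤ => ((1 + ‖latticeVec m‖) ^ (n + 1))⁻¹ := by
  have hint : Integrable fun x : Euc n => ((1 + ‖x‖) ^ (n + 1))⁻¹ := by
    have h := integrable_one_add_norm (μ := (volume : Measure (Euc n))) (r := ((n + 1 : ℕ) : ℝ))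
      (by simp)
    refine h.congr (.of_forall fun x => ?_)
    simp only
    rw [Real.rpow_neg (by positivity), Real.rpow_natCast]
  have hs := (hasSum_setIntegral_kleinCell hint).summable.mul_left (((1 : ℝ) + n) ^ (n + 1))
  refine Summable.of_nonneg_of_le (fun m => by positivity) (fun m => ?_) hs
  have hc : ∫ _x in kleinCell n, ((1 + (n : ℝ)) ^ (n + 1))⁻¹ * ((1 + ‖latticeVec m‖) ^ (n + 1))⁻¹ =
      ((1 + (n : ℝ)) ^ (n + 1))⁻¹ * ((1 + ‖latticeVec m‖) ^ (n + 1))⁻¹ := by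
    rw [setIntegral_const, volume_real_kleinCell, one_smul]
  have hfin : volume (kleinCell n) ≠ ⊤ := by
    intro h
    have := volume_real_kleinCell n
    simp [Measure.real, h] at this
  have hle := setIntegral_mono_on (μ := volume) (s := kleinCell n)
    (f := fun _ => ((1 + (n : ℝ)) ^ (n + 1))⁻¹ * ((1 + ‖latticeVec m‖) ^ (n + 1))⁻¹)
    (g := fun x => ((1 + ‖kleinMap m x‖) ^ (n + 1))⁻¹)
    (integrableOn_const hfin)
    (((measurePreserving_kleinMap m).integrable_comp_emb
      (measurableEmbedding_kleinMap m)).2 hint).integrableOn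
    (measurableSet_kleinCell n) (fun x hx => by
      have h1 := norm_kleinMap_le m x
      have h2 := norm_le_of_mem_kleinCell hx
      rw [← mul_inv, ← mul_pow]
      refine inv_anti₀ (by positivity) (pow_le_pow_left₀ (by positivity) ?_ _)
      nlinarith [norm_nonneg (latticeVec m), norm_nonneg x])
  rw [hc] at hle
  calc ((1 + ‖latticeVec m‖) ^ (n + 1))⁻¹
      = (1 + (n : ℝ)) ^ (n + 1) *
        (((1 + (n : ℝ)) ^ (n + 1))⁻¹ * ((1 + ‖latticeVec m‖) ^ (n + 1))⁻¹) := by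
        rw [← mul_assoc, mul_inv_cancel₀ (by positivity), one_mul]
    _ ≤ _ := by gcongr

/-! ### Derivatives and decay of the kernel -/

section RadialBessel

variable {E : Type*} [NormedAddCommGroup E] [InnerProductSpace ℝ E]

theorem contDiffOn_besselInt_norm_sq {α : ℝ} (hα : 0 < α) (k : ℕ) :
    ContDiffOn ℝ ∞ (fun x : E => besselInt α k (‖x‖ ^ 2)) {0}ᶜ :=
  (contDiffOn_besselInt hα k).comp (contDiff_norm_sq ℝ).contDiffOn
    fun _ hx => Set.mem_Ioi.2 (pow_pos (norm_pos_iff.2 hx) 2)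

/-- Away from the origin, every derivative of `J_k(|x|²)` decays faster than any power of `|x|`. -/
theorem exists_norm_iteratedFDeriv_besselInt_le {α δ : ℝ} (hα : 0 < α) (hδ : 0 < δ) (k j p : ℕ) :
    ∃ C, 0 ≤ C ∧ ∀ x : E, δ ≤ ‖x‖ →
      ‖iteratedFDeriv ℝ j (fun x : E => besselInt α k (‖x‖ ^ 2)) x‖ ≤ C * ((1 + ‖x‖) ^ p)⁻¹ := by
  obtain ⟨q, A, hA, hq⟩ :=
    (Function.hasTemperateGrowth_norm_sq (H := E)).norm_iteratedFDeriv_le_uniform j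
  choose B hB hBle using fun i => exists_besselInt_le hα hδ (k + 2 * i) (p + q * j)
  refine ⟨j.factorial * (∑ i ∈ Finset.range (j + 1), B i) * (1 + A) ^ j,
    mul_nonneg (mul_nonneg (by positivity) (Finset.sum_nonneg fun i _ => hB i)) (by positivity),
    fun x hx => ?_⟩
  have hr : 0 < ‖x‖ := hδ.trans_le hx
  have hr2 : 0 < ‖x‖ ^ 2 := by positivity
  set r := ‖x‖ with hrdef
  have hx0 : x ∈ ({0}ᶜ : Set E) := norm_pos_iff.1 hr
  have ho : IsOpen ({0}ᶜ : Set E) := isOpen_compl_singleton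
  have hC : ∀ i, i ≤ j → ‖iteratedFDerivWithin ℝ i (besselInt α k) (Set.Ioi 0) (‖x‖ ^ 2)‖ ≤
      (∑ i ∈ Finset.range (j + 1), B i) * ((1 + r) ^ (p + q * j))⁻¹ := by
    intro i hi
    rw [iteratedFDerivWithin_of_isOpen i isOpen_Ioi hr2, norm_iteratedFDeriv_besselInt hα hr2]
    have h1 : (1 / 4 : ℝ) ^ i ≤ 1 := pow_le_one₀ (by norm_num) (by norm_num)
    have h2 := besselInt_nonneg α (k + 2 * i) (r ^ 2)
    have h3 : B i ≤ ∑ i ∈ Finset.range (j + 1), B i :=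
      Finset.single_le_sum (fun i _ => hB i) (Finset.mem_range.2 (by omega))
    calc (1 / 4 : ℝ) ^ i * besselInt α (k + 2 * i) (r ^ 2)
        ≤ besselInt α (k + 2 * i) (r ^ 2) := mul_le_of_le_one_left h2 h1
      _ ≤ B i * ((1 + r) ^ (p + q * j))⁻¹ := hBle i r hx
      _ ≤ _ := by gcongr
  have hD : ∀ i, 1 ≤ i → i ≤ j →
      ‖iteratedFDerivWithin ℝ i (fun x : E => ‖x‖ ^ 2) {0}ᶜ x‖ ≤ ((1 + A) * (1 + r) ^ q) ^ i := by
    intro i hi hij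
    rw [iteratedFDerivWithin_of_isOpen i ho hx0]
    have h1 : 1 ≤ (1 + A) * (1 + r) ^ q :=
      one_le_mul_of_one_le_of_one_le (by linarith) (one_le_pow₀ (by linarith))
    calc _ ≤ A * (1 + r) ^ q := hq i hij x
      _ ≤ (1 + A) * (1 + r) ^ q := by gcongr; linarith
      _ ≤ _ := le_self_pow₀ h1 (by omega)
  have h := norm_iteratedFDerivWithin_comp_le (contDiffOn_besselInt hα k)
    (contDiff_norm_sq ℝ).contDiffOn (n := j) (by exact_mod_cast le_top) isOpen_Ioi.uniqueDiffOn
    ho.uniqueDiffOn (fun y hy => Set.mem_Ioi.2 (pow_pos (norm_pos_iff.2 hy) 2)) hx0 hC hD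
  rw [iteratedFDerivWithin_of_isOpen j ho hx0] at h
  refine h.trans (le_of_eq ?_)
  rw [mul_pow, ← pow_mul, pow_add]
  field_simp

end RadialBessel

/-- The constant of the heat integral as a real-linear map into `ℂ`. -/
noncomputable def heatConstCLM (n : ℕ) : ℝ →L[ℝ] ℂ := heatConst n • Complex.ofRealCLM

theorem euclidKernel_eventuallyEq {n : ℕ} (hn : 1 ≤ n) {α : ℝ} (hα : 0 < α) {x : Euc n}
    (hx : x ≠ 0) :
    euclidKernel n α =ᶠ[nhds x]
      heatConstCLM n ∘ fun y : Euc n => besselInt α (n - 1) (‖y‖ ^ 2) := by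
  filter_upwards [isOpen_compl_singleton.mem_nhds hx] with y hy
  rw [euclidKernel_eq hn hα hy]
  simp [heatConstCLM]

theorem contDiffAt_besselInt_norm_sq {n : ℕ} {α : ℝ} (hα : 0 < α) (k : ℕ) {x : Euc n}
    (hx : x ≠ 0) : ContDiffAt ℝ ∞ (fun y : Euc n => besselInt α k (‖y‖ ^ 2)) x :=
  (contDiffOn_besselInt_norm_sq hα k).contDiffAt (isOpen_compl_singleton.mem_nhds hx)

theorem contDiffAt_euclidKernel {n : ℕ} (hn : 1 ≤ n) {α : ℝ} (hα : 0 < α) {x : Euc n}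
    (hx : x ≠ 0) : ContDiffAt ℝ ∞ (euclidKernel n α) x :=
  ((heatConstCLM n).contDiff.contDiffAt.comp x
    (contDiffAt_besselInt_norm_sq hα _ hx)).congr_of_eventuallyEq
      (euclidKernel_eventuallyEq hn hα hx)

theorem exists_norm_iteratedFDeriv_euclidKernel_le {n : ℕ} (hn : 1 ≤ n) {α δ : ℝ} (hα : 0 < α)
    (hδ : 0 < δ) (j p : ℕ) :
    ∃ C, 0 ≤ C ∧ ∀ x : Euc n, δ ≤ ‖x‖ →
      ‖iteratedFDeriv ℝ j (euclidKernel n α) x‖ ≤ C * ((1 + ‖x‖) ^ p)⁻¹ := by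
  obtain ⟨C, hC, h⟩ := exists_norm_iteratedFDeriv_besselInt_le (E := Euc n) hα hδ (n - 1) j p
  refine ⟨‖heatConstCLM n‖ * C, by positivity, fun x hx => ?_⟩
  have hx0 : x ≠ 0 := norm_pos_iff.1 (hδ.trans_le hx)
  rw [((euclidKernel_eventuallyEq hn hα hx0).iteratedFDeriv ℝ j).eq_of_nhds,
    (heatConstCLM n).iteratedFDeriv_comp_left (contDiffAt_besselInt_norm_sq hα _ hx0)
      (by exact_mod_cast le_top)]
  refine (ContinuousLinearMap.norm_compContinuousMultilinearMap_le _ _).trans ?_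
  rw [mul_assoc]
  gcongr
  exact h x hx

theorem kleinGordon_euclidKernel {n : ℕ} (hn : 1 ≤ n) {α : ℝ} (hα : 0 < α) {x : Euc n}
    (hx : x ≠ 0) : kleinGordon α (euclidKernel n α) x = 0 := by
  have hr : 0 < ‖x‖ ^ 2 := by have := norm_pos_iff.2 hx; positivity
  have h1 : Δ (euclidKernel n α) x =
      heatConstCLM n (Δ (fun y : Euc n => besselInt α (n - 1) (‖y‖ ^ 2)) x) := by
    rw [(InnerProductSpace.laplacian_congr_nhds (euclidKernel_eventuallyEq hn hα hx)).eq_of_nhds]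
    exact (contDiffAt_infty.1 (contDiffAt_besselInt_norm_sq hα _ hx) 2).laplacian_CLM_comp_left
  have h2 := laplacian_comp_norm_sq (x := x) (f := besselInt α (n - 1))
    (Filter.eventually_of_mem (Ioi_mem_nhds hr) fun w hw => hasDerivAt_besselInt hα hw (n - 1))
    ((hasDerivAt_besselInt hα hr (n - 1 + 2)).const_mul (-(1 / 4)))
  have h3 := besselInt_recurrence hα hr (n - 1)
  have hn' : ((n - 1 : ℕ) : ℝ) + 1 = n := by
    rw [← Nat.cast_add_one, Nat.sub_add_cancel hn]
  have h4 : Δ (fun y : Euc n => besselInt α (n - 1) (‖y‖ ^ 2)) x =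
      α ^ 2 * besselInt α (n - 1) (‖x‖ ^ 2) := by
    rw [h2, finrank_euclideanSpace, Fintype.card_fin]
    rw [hn'] at h3
    linear_combination (1 / 2 : ℝ) * h3
  rw [kleinGordon, h1, h4, euclidKernel_eq hn hα hx]
  simp [heatConstCLM]
  ring

/-! ### The twisted lattice sum off the lattice -/

theorem twistedTerm_cases {n : ℕ} (l : ℕ) (α : ℝ) (m : Fin n → ℤ) :
    twistedTerm l α m = (fun x => euclidKernel n α (kleinMap m x)) ∨
      twistedTerm l α m = -(fun x => euclidKernel n α (kleinMap m x)) := by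
  rcases paritySign_cases l m with h | h
  · exact Or.inl (by funext x; simp [twistedTerm, h])
  · exact Or.inr (by funext x; simp [twistedTerm, h])

theorem norm_iteratedFDeriv_twistedTerm {n : ℕ} (l : ℕ) (α : ℝ) (m : Fin n → ℤ) (j : ℕ)
    (x : Euc n) :
    ‖iteratedFDeriv ℝ j (twistedTerm l α m) x‖ =
      ‖iteratedFDeriv ℝ j (euclidKernel n α) (kleinMap m x)‖ := by
  have h : ‖iteratedFDeriv ℝ j (fun x => euclidKernel n α (kleinMap m x)) x‖ =
      ‖iteratedFDeriv ℝ j (euclidKernel n α) (kleinMap m x)‖ := by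
    have he : (fun x => euclidKernel n α (kleinMap m x)) =
        (fun y => euclidKernel n α (y + latticeVec m)) ∘ reflectIso m := by
      funext y
      rw [Function.comp_apply, kleinMap_eq_reflectIso]
    rw [he, LinearIsometryEquiv.norm_iteratedFDeriv_comp_right, iteratedFDeriv_comp_add_right,
      kleinMap_eq_reflectIso]
  rcases twistedTerm_cases l α m with h' | h' <;> rw [h']
  · exact h
  · rw [iteratedFDeriv_neg, Pi.neg_apply, norm_neg, h]

theorem contDiff_kleinMap {n : ℕ} (m : Fin n → ℤ) : ContDiff ℝ ∞ (kleinMap m) := by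
  rw [show kleinMap m = fun x => reflectIso m x + latticeVec m from
    funext (kleinMap_eq_reflectIso m)]
  exact (reflectIso m).contDiff.add contDiff_const

theorem contDiffAt_twistedTerm {n : ℕ} (hn : 1 ≤ n) (l : ℕ) {α : ℝ} (hα : 0 < α) (m : Fin n → ℤ)
    {x : Euc n} (hx : x ∉ lattice n) : ContDiffAt ℝ ∞ (twistedTerm l α m) x :=
  contDiffAt_const.mul ((contDiffAt_euclidKernel hn hα (kleinMap_ne_zero hx m)).comp x
    (contDiff_kleinMap m).contDiffAt)

/-- Normal convergence of the twisted sum and of all its derivatives. -/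
theorem exists_summable_norm_iteratedFDeriv_twistedTerm_le {n : ℕ} (hn : 1 ≤ n) (l : ℕ) {α : ℝ}
    (hα : 0 < α) {C : Set (Euc n)} (hC : IsCompact C) (hd : Disjoint C (lattice n)) (j : ℕ) :
    ∃ b : (Fin n → ℤ) → ℝ, Summable b ∧
      ∀ m, ∀ x ∈ C, ‖iteratedFDeriv ℝ j (twistedTerm l α m) x‖ ≤ b m := by
  obtain ⟨δ, hδ, hδle⟩ := exists_le_norm_kleinMap hC hd
  obtain ⟨R, hR⟩ := hC.isBounded.exists_norm_le
  obtain ⟨A, hA, hAle⟩ := exists_norm_iteratedFDeriv_euclidKernel_le hn hα hδ j (n + 1)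
  refine ⟨fun m => A * ((1 + R) ^ (n + 1) * ((1 + ‖latticeVec m‖) ^ (n + 1))⁻¹),
    ((summable_inv_one_add_norm_latticeVec n).mul_left _).mul_left _, fun m x hx => ?_⟩
  rw [norm_iteratedFDeriv_twistedTerm]
  exact (hAle _ (hδle x hx m)).trans
    (mul_le_mul_of_nonneg_left (inv_one_add_norm_kleinMap_le (n + 1) (hR x hx) m) hA)

theorem exists_closedBall_disjoint_lattice {n : ℕ} {x : Euc n} (hx : x ∉ lattice n) :
    ∃ ε > 0, Disjoint (Metric.closedBall x ε) (lattice n) := by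
  obtain ⟨ε, hε, h⟩ := Metric.nhds_basis_closedBall.mem_iff.1
    ((isClosed_lattice n).isOpen_compl.mem_nhds hx)
  exact ⟨ε, hε, Set.disjoint_left.2 fun y hy => h hy⟩

theorem contDiffAt_twistedSum {n : ℕ} (hn : 1 ≤ n) (l : ℕ) {α : ℝ} (hα : 0 < α) {x : Euc n}
    (hx : x ∉ lattice n) : ContDiffAt ℝ ∞ (twistedSum (n := n) l α) x := by
  obtain ⟨ε, hε, hd⟩ := exists_closedBall_disjoint_lattice hx
  choose v hv hb using fun j => exists_summable_norm_iteratedFDeriv_twistedTerm_le hn l hα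
    (isCompact_closedBall x ε) hd j
  exact (contDiffOn_tsum_of_isPreconnected Metric.isOpen_ball
    (convex_ball x ε).isPreconnected
    (fun m y hy => (contDiffAt_twistedTerm hn l hα m (Set.disjoint_left.1 hd
      (Metric.ball_subset_closedBall hy))).contDiffWithinAt) hv
    (fun j m y hy => hb j m y (Metric.ball_subset_closedBall hy))).contDiffAt
      (Metric.ball_mem_nhds x hε)

theorem laplacian_twistedTerm {n : ℕ} (hn : 1 ≤ n) (l : ℕ) {α : ℝ} (hα : 0 < α) (m : Fin n → ℤ)
    {x : Euc n} (hx : x ∉ lattice n) : Δ (twistedTerm l α m) x = α ^ 2 * twistedTerm l α m x := by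
  have h := kleinGordon_comp_kleinMap α (euclidKernel n α) m x
  rw [kleinGordon_euclidKernel hn hα (kleinMap_ne_zero hx m), kleinGordon, sub_eq_zero] at h
  rcases twistedTerm_cases l α m with h' | h' <;> rw [h']
  · exact h
  · rw [InnerProductSpace.laplacian_neg, Pi.neg_apply, Pi.neg_apply, h, mul_neg]

theorem kleinGordon_twistedSum {n : ℕ} (hn : 1 ≤ n) (l : ℕ) {α : ℝ} (hα : 0 < α) {x : Euc n}
    (hx : x ∉ lattice n) : kleinGordon α (twistedSum (n := n) l α) x = 0 := by
  obtain ⟨ε, hε, hd⟩ := exists_closedBall_disjoint_lattice hx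
  choose v hv hb using fun j => exists_summable_norm_iteratedFDeriv_twistedTerm_le hn l hα
    (isCompact_closedBall x ε) hd j
  have h := laplacian_tsum_of_isPreconnected Metric.isOpen_ball
    (convex_ball x ε).isPreconnected
    (fun m y hy => (contDiffAt_twistedTerm hn l hα m (Set.disjoint_left.1 hd
      (Metric.ball_subset_closedBall hy))).contDiffWithinAt) hv
    (fun j m y hy => hb j m y (Metric.ball_subset_closedBall hy)) (Metric.mem_ball_self hε)
  rw [kleinGordon, sub_eq_zero]
  refine h.trans ?_
  simp_rw [laplacian_twistedTerm hn l hα _ hx]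
  rw [tsum_mul_left]
  rfl

/-! ### Equivariance of the twisted sum -/

theorem lastSign_kleinInv {n : ℕ} (m : Fin n → ℤ) (i : Fin n) :
    lastSign (kleinInv m) i = lastSign m i := by
  have h : lastSign (kleinInv m) i * lastSign m i = 1 := by
    rw [← lastSign_kleinComp, kleinComp_inv]
    simp [lastSign]
  have h2 := lastSign_mul_self m i
  rcases lastSign_cases m i with e | e <;> rw [e] at h ⊢ <;> linarith

/-- Composition with `kleinMap k` on the right permutes the indices. -/
def kleinCompRight {n : ℕ} (k : Fin n → ℤ) : (Fin n → ℤ) ≃ (Fin n → ℤ) where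
  toFun m := kleinComp m k
  invFun m := kleinComp m (kleinInv k)
  left_inv m := by
    funext i
    have h := lastSign_mul_self k i
    simp only [kleinComp, lastSign_kleinComp, kleinInv]
    linear_combination (-lastSign m i * k i) * h
  right_inv m := by
    funext i
    have h := lastSign_kleinInv k i
    simp only [kleinComp, lastSign_kleinComp, kleinInv] at h ⊢
    rw [h]
    ring

theorem paritySign_mul_self {n : ℕ} (l : ℕ) (m : Fin n → ℤ) :
    paritySign l m * paritySign l m = 1 := by
  rcases paritySign_cases l m with h | h <;> simp [h]

theorem isEquivariant_twistedSum (n l : ℕ) (α : ℝ) :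
    IsEquivariant l (twistedSum (n := n) l α) := by
  intro k x
  rw [twistedSum, twistedSum, smul_eq_mul, ← tsum_mul_left,
    ← (kleinCompRight k).tsum_eq fun m => paritySign l k * twistedTerm l α m x]
  refine tsum_congr fun m => ?_
  change _ = paritySign l k * twistedTerm l α (kleinComp m k) x
  rw [twistedTerm, twistedTerm, paritySign_kleinComp, kleinMap_kleinMap]
  linear_combination (-(paritySign l m * euclidKernel n α (kleinMap (kleinComp m k) x))) *
    paritySign_mul_self l k

theorem twistedSum_add_latticeVec {n : ℕ} (l : ℕ) (α : ℝ) (k : Fin n → ℤ) (x : Euc n) :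
    twistedSum l α (x + latticeVec k) = paritySign l k * twistedSum l α (reflectLast k x) := by
  rw [← smul_eq_mul, ← isEquivariant_twistedSum n l α k]
  congr 1
  ext i
  have h : (lastSign k i : ℝ) * lastSign k i = 1 := by exact_mod_cast lastSign_mul_self k i
  simp only [kleinMap, reflectLast, PiLp.add_apply]
  linear_combination (-x i) * h

/-! ### The Gaussian average -/

theorem integrable_exp_neg_mul_norm_sq (n : ℕ) {b : ℝ} (hb : 0 < b) :
    Integrable fun y : Euc n => Real.exp (-b * ‖y‖ ^ 2) := by
  refine Integrable.of_integral_ne_zero ?_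
  rw [GaussianFourier.integral_rexp_neg_mul_sq_norm hb]
  positivity

/-- The Gaussian density `(4π)^{-n/2} e^{-|y|²/4}`, the heat kernel at time `1`. -/
noncomputable def gaussDensity (n : ℕ) (y : Euc n) : ℝ :=
  ((4 * Real.pi) ^ ((n : ℝ) / 2))⁻¹ * Real.exp (-(1 / 4) * ‖y‖ ^ 2)

theorem gaussDensity_nonneg {n : ℕ} (y : Euc n) : 0 ≤ gaussDensity n y := by
  unfold gaussDensity
  positivity

theorem continuous_gaussDensity (n : ℕ) : Continuous (gaussDensity n) := by
  unfold gaussDensity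
  fun_prop

theorem integrable_gaussDensity (n : ℕ) : Integrable (gaussDensity n) :=
  (integrable_exp_neg_mul_norm_sq n (by norm_num)).const_mul _

theorem integral_gaussDensity (n : ℕ) : ∫ y, gaussDensity n y = 1 := by
  unfold gaussDensity
  rw [integral_const_mul, GaussianFourier.integral_rexp_neg_mul_sq_norm (by norm_num),
    finrank_euclideanSpace, Fintype.card_fin, show Real.pi / (1 / 4) = 4 * Real.pi by ring]
  exact inv_mul_cancel₀ (by positivity)

theorem integrable_norm_mul_gaussDensity (n : ℕ) :
    Integrable fun y : Euc n => ‖y‖ * gaussDensity n y := by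
  obtain ⟨C, hC, h⟩ := exists_pow_le_exp_sq (show (0 : ℝ) < 1 / 8 by norm_num) 1
  refine ((integrable_exp_neg_mul_norm_sq n (b := 1 / 8) (by norm_num)).const_mul
    (C * ((4 * Real.pi) ^ ((n : ℝ) / 2))⁻¹)).mono'
    (continuous_norm.mul (continuous_gaussDensity n)).aestronglyMeasurable (.of_forall fun y => ?_)
  rw [Real.norm_of_nonneg (mul_nonneg (norm_nonneg _) (gaussDensity_nonneg y))]
  have h1 := h ‖y‖ (norm_nonneg y)
  rw [pow_one] at h1
  have h2 : Real.exp (1 / 8 * ‖y‖ ^ 2) * Real.exp (-(1 / 4) * ‖y‖ ^ 2) =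
      Real.exp (-(1 / 8) * ‖y‖ ^ 2) := by
    rw [← Real.exp_add]
    ring_nf
  rw [gaussDensity, ← h2]
  calc _ ≤ (C * Real.exp (1 / 8 * ‖y‖ ^ 2)) *
        (((4 * Real.pi) ^ ((n : ℝ) / 2))⁻¹ * Real.exp (-(1 / 4) * ‖y‖ ^ 2)) := by gcongr
    _ = _ := by ring

theorem hasFDerivAt_gaussDensity {n : ℕ} (y : Euc n) :
    HasFDerivAt (gaussDensity n) ((-(1 / 2) * gaussDensity n y) • innerSL ℝ y) y := by
  have h : HasDerivAt (fun w : ℝ => ((4 * Real.pi) ^ ((n : ℝ) / 2))⁻¹ * Real.exp (-(1 / 4) * w))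
      (-(1 / 4) * gaussDensity n y) (‖y‖ ^ 2) := by
    refine HasDerivAt.congr_deriv
      ((((hasDerivAt_id _).const_mul (-(1 / 4) : ℝ)).exp).const_mul _) ?_
    rw [gaussDensity, id_eq]
    ring
  have h2 := hasFDerivAt_comp_norm_sq h
  rw [show 2 * (-(1 / 4) * gaussDensity n y) = -(1 / 2) * gaussDensity n y by ring] at h2
  exact h2

theorem integrable_gaussDensity_smul {n : ℕ} {V : Type*} [NormedAddCommGroup V] [NormedSpace ℝ V]
    {f : Euc n → V} (hf : Continuous f) {B : ℝ} (hB : ∀ x, ‖f x‖ ≤ B) :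
    Integrable fun y => gaussDensity n y • f y := by
  refine ((integrable_gaussDensity n).mul_const B).mono'
    ((continuous_gaussDensity n).smul hf).aestronglyMeasurable (.of_forall fun y => ?_)
  rw [norm_smul, Real.norm_of_nonneg (gaussDensity_nonneg y)]
  exact mul_le_mul_of_nonneg_left (hB y) (gaussDensity_nonneg y)

/-- The function and its derivatives of order one and two are bounded, by a common constant. -/
def HasBoundedDerivs {n : ℕ} (ψ : Euc n → ℂ) : Prop :=
  ∃ B, ∀ j ≤ 2, ∀ x, ‖iteratedFDeriv ℝ j ψ x‖ ≤ B

/-- The average `∫ g(y) ψ(ty) dy`, that is, the heat flow of `ψ` at time `t²` and the origin. -/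
noncomputable def gaussAverage {n : ℕ} (ψ : Euc n → ℂ) (t : ℝ) : ℂ :=
  ∫ y, gaussDensity n y • ψ (t • y)

/-- Integration by parts against the Gaussian, whose gradient is `-y/2` times itself. -/
theorem integral_gaussDensity_smul_fderiv {n : ℕ} {ψ : Euc n → ℂ} (hψ : ContDiff ℝ ∞ ψ)
    (hb : HasBoundedDerivs ψ) (t : ℝ) :
    ∫ y, gaussDensity n y • fderiv ℝ ψ (t • y) y = (2 * t) • gaussAverage (Δ ψ) t := by
  obtain ⟨B, hB⟩ := hb
  have hB1 (x : Euc n) : ‖fderiv ℝ ψ x‖ ≤ B := by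
    rw [← norm_iteratedFDeriv_one]
    exact hB 1 (by norm_num) x
  let e : Fin n → Euc n := EuclideanSpace.basisFun (Fin n) ℝ
  have he (i : Fin n) : ‖e i‖ = 1 := (EuclideanSpace.basisFun (Fin n) ℝ).norm_eq_one i
  have hd1 : ContDiff ℝ ∞ (fderiv ℝ ψ) := hψ.fderiv_right (by exact_mod_cast le_top)
  let h : Fin n → Euc n → ℂ := fun i y => fderiv ℝ ψ (t • y) (e i)
  have hh (i : Fin n) (y : Euc n) : HasFDerivAt (h i)
      (((ContinuousLinearMap.apply ℝ ℂ (e i)).comp (fderiv ℝ (fderiv ℝ ψ) (t • y))).comp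
        (t • ContinuousLinearMap.id ℝ (Euc n))) y := by
    have h1 : HasFDerivAt (fderiv ℝ ψ) _ (t • y) :=
      (hd1.differentiable (by simp) (t • y)).hasFDerivAt
    exact ((ContinuousLinearMap.apply ℝ ℂ (e i)).hasFDerivAt.comp (t • y) h1).comp y
      ((hasFDerivAt_id y).const_smul t)
  have hh' (i : Fin n) (y : Euc n) :
      fderiv ℝ (h i) y (e i) = t • iteratedFDeriv ℝ 2 ψ (t • y) ![e i, e i] := by
    rw [(hh i y).fderiv, iteratedFDeriv_two_apply]
    simp
  have hhc (i : Fin n) : Continuous (h i) :=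
    continuous_iff_continuousAt.2 fun y => (hh i y).continuousAt
  have hhb (i : Fin n) (y : Euc n) : ‖h i y‖ ≤ B := by
    refine ((fderiv ℝ ψ (t • y)).le_opNorm _).trans ?_
    rw [he, mul_one]
    exact hB1 _
  have hc2 (i : Fin n) : Continuous fun y => iteratedFDeriv ℝ 2 ψ (t • y) ![e i, e i] := by
    have h1 : Continuous (iteratedFDeriv ℝ 2 ψ) :=
      (contDiff_infty.1 hψ 2).continuous_iteratedFDeriv le_rfl
    exact (ContinuousMultilinearMap.apply ℝ (fun _ : Fin 2 => Euc n) ℂ _).continuous.comp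
      (h1.comp (continuous_const_smul t))
  have hb2 (i : Fin n) (y : Euc n) : ‖iteratedFDeriv ℝ 2 ψ (t • y) ![e i, e i]‖ ≤ B := by
    refine (ContinuousMultilinearMap.le_opNorm _ _).trans ?_
    simp only [Fin.prod_univ_two, Matrix.cons_val_zero, Matrix.cons_val_one, he, mul_one]
    exact hB 2 le_rfl _
  have hg (i : Fin n) (y : Euc n) :
      fderiv ℝ (gaussDensity n) y (e i) = -(1 / 2) * gaussDensity n y * y i := by
    rw [(hasFDerivAt_gaussDensity y).fderiv]
    simp [e, EuclideanSpace.inner_single_right]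
  have hgc (i : Fin n) : Continuous fun y => fderiv ℝ (gaussDensity n) y (e i) := by
    simp_rw [hg]
    have := continuous_gaussDensity n
    fun_prop
  have hi2 (i : Fin n) :
      Integrable fun y => gaussDensity n y • iteratedFDeriv ℝ 2 ψ (t • y) ![e i, e i] :=
    integrable_gaussDensity_smul (hc2 i) (hb2 i)
  have hi1 (i : Fin n) : Integrable fun y => fderiv ℝ (gaussDensity n) y (e i) • h i y := by
    refine ((integrable_norm_mul_gaussDensity n).mul_const (1 / 2 * B)).mono'
      ((hgc i).smul (hhc i)).aestronglyMeasurable (.of_forall fun y => ?_)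
    have h1 : ‖y i‖ ≤ ‖y‖ := PiLp.norm_apply_le y i
    have h2 := gaussDensity_nonneg y
    rw [norm_smul, hg, norm_mul, norm_mul, Real.norm_of_nonneg h2,
      show ‖(-(1 / 2) : ℝ)‖ = 1 / 2 by norm_num]
    calc 1 / 2 * gaussDensity n y * ‖y i‖ * ‖h i y‖
        ≤ 1 / 2 * gaussDensity n y * ‖y‖ * B := by
          gcongr
          exact hhb i y
      _ = _ := by ring
  have hibp (i : Fin n) : ∫ y, fderiv ℝ (gaussDensity n) y (e i) • h i y =
      -(t • ∫ y, gaussDensity n y • iteratedFDeriv ℝ 2 ψ (t • y) ![e i, e i]) := by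
    have h1 := integral_smul_fderiv_eq_neg_fderiv_smul_of_integrable (μ := volume)
      (f := gaussDensity n) (g := h i) (v := e i) (hi1 i)
      (by
        simp_rw [hh', smul_comm (_ : ℝ) t]
        exact (hi2 i).smul t)
      (integrable_gaussDensity_smul (hhc i) (hhb i))
      (fun y _ => (hasFDerivAt_gaussDensity y).differentiableAt)
      (fun y _ => (hh i y).differentiableAt)
    simp_rw [hh', smul_comm (_ : ℝ) t] at h1
    rw [integral_smul] at h1
    rw [h1, neg_neg]
  have hsplit (y : Euc n) : gaussDensity n y • fderiv ℝ ψ (t • y) y =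
      ∑ i, (-2 : ℝ) • (fderiv ℝ (gaussDensity n) y (e i) • h i y) := by
    have hy : y = ∑ i, y i • e i := by
      exact ((EuclideanSpace.basisFun (Fin n) ℝ).sum_repr y).symm
    conv_lhs => rw [hy, map_sum, Finset.smul_sum, ← hy]
    refine Finset.sum_congr rfl fun i _ => ?_
    rw [map_smul, smul_smul, smul_smul, hg]
    congr 1
    ring
  simp_rw [hsplit]
  rw [integral_finsetSum (f := fun i y => (-2 : ℝ) • (fderiv ℝ (gaussDensity n) y (e i) • h i y)) _
    fun i _ => (hi1 i).smul (-2 : ℝ)]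
  simp_rw [integral_smul, hibp]
  rw [gaussAverage]
  simp_rw [InnerProductSpace.laplacian_eq_iteratedFDeriv_orthonormalBasis ψ
    (EuclideanSpace.basisFun (Fin n) ℝ), Finset.smul_sum]
  rw [integral_finsetSum _ fun i _ => hi2 i, Finset.smul_sum]
  refine Finset.sum_congr rfl fun i _ => ?_
  rw [smul_neg, neg_smul, neg_neg, smul_smul]

theorem hasDerivAt_gaussAverage {n : ℕ} {ψ : Euc n → ℂ} (hψ : ContDiff ℝ ∞ ψ)
    (hb : HasBoundedDerivs ψ) (t : ℝ) :
    HasDerivAt (gaussAverage ψ) ((2 * t) • gaussAverage (Δ ψ) t) t := by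
  rw [← integral_gaussDensity_smul_fderiv hψ hb]
  obtain ⟨B, hB⟩ := hb
  have hB0 (x : Euc n) : ‖ψ x‖ ≤ B := by
    rw [← norm_iteratedFDeriv_zero (𝕜 := ℝ)]
    exact hB 0 (by norm_num) x
  have hB1 (x : Euc n) : ‖fderiv ℝ ψ x‖ ≤ B := by
    rw [← norm_iteratedFDeriv_one]
    exact hB 1 (by norm_num) x
  have hc (s : ℝ) : Continuous fun y : Euc n => ψ (s • y) :=
    hψ.continuous.comp (continuous_const_smul s)
  have hc1 : Continuous fun y : Euc n => fderiv ℝ ψ (t • y) y :=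
    ((hψ.continuous_fderiv (by simp)).comp (continuous_const_smul t)).clm_apply continuous_id
  refine (hasDerivAt_integral_of_dominated_loc_of_deriv_le (s := Set.univ)
    (F := fun s y => gaussDensity n y • ψ (s • y))
    (F' := fun s y => gaussDensity n y • fderiv ℝ ψ (s • y) y)
    (bound := fun y => ‖y‖ * gaussDensity n y * B) Filter.univ_mem
    (.of_forall fun s => ((continuous_gaussDensity n).smul (hc s)).aestronglyMeasurable)
    (integrable_gaussDensity_smul (hc t) fun y => hB0 _)
    ((continuous_gaussDensity n).smul hc1).aestronglyMeasurable
    (.of_forall fun y s _ => ?_) ((integrable_norm_mul_gaussDensity n).mul_const B)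
    (.of_forall fun y s _ => ?_)).2
  · rw [norm_smul, Real.norm_of_nonneg (gaussDensity_nonneg y)]
    have h1 := (fderiv ℝ ψ (s • y)).le_opNorm y
    have h2 := gaussDensity_nonneg y
    calc gaussDensity n y * ‖fderiv ℝ ψ (s • y) y‖
        ≤ gaussDensity n y * (B * ‖y‖) := by
          gcongr
          exact h1.trans (by gcongr; exact hB1 _)
      _ = _ := by ring
  · have h1 : HasDerivAt (fun s : ℝ => s • y) y s := by
      simpa using (hasDerivAt_id s).smul_const y
    have h2 : HasDerivAt (fun s : ℝ => ψ (s • y)) (fderiv ℝ ψ (s • y) y) s :=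
      (hψ.differentiable (by simp) (s • y)).hasFDerivAt.comp_hasDerivAt s h1
    exact h2.const_smul (gaussDensity n y)

/-! ### The fundamental solution on Euclidean space -/

/-- The kernel of `euclidKernel` in space and time,
`-2 (4π)^{-n/2} t^{1-n} e^{-α²t² - |x|²/(4t²)}`. -/
noncomputable def heatKern (n : ℕ) (α : ℝ) (x : Euc n) (t : ℝ) : ℝ :=
  heatConst n * besselKern α (n - 1) (‖x‖ ^ 2) t

theorem heatKern_eq {n : ℕ} (hn : 1 ≤ n) (α : ℝ) (x : Euc n) {t : ℝ} (ht : 0 < t) :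
    heatKern n α x t =
      -(2 * t * Real.exp (-α ^ 2 * t ^ 2)) * (t⁻¹ ^ n * gaussDensity n (t⁻¹ • x)) := by
  obtain ⟨k, rfl⟩ := Nat.exists_eq_add_of_le' hn
  have e : t * t⁻¹ = 1 := mul_inv_cancel₀ ht.ne'
  rw [heatKern, besselKern, gaussDensity, heatConst, norm_smul, mul_pow, Real.norm_eq_abs, sq_abs,
    Nat.add_sub_cancel, sub_eq_add_neg, Real.exp_add,
    show -(‖x‖ ^ 2 * t⁻¹ ^ 2 / 4) = -(1 / 4) * (t⁻¹ ^ 2 * ‖x‖ ^ 2) by ring,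
    show -(α ^ 2 * t ^ 2) = -α ^ 2 * t ^ 2 by ring, pow_succ t⁻¹ k]
  generalize Real.exp (-α ^ 2 * t ^ 2) = X
  generalize Real.exp (-(1 / 4) * (t⁻¹ ^ 2 * ‖x‖ ^ 2)) = Y
  generalize ((4 * Real.pi) ^ (((k + 1 : ℕ) : ℝ) / 2))⁻¹ = Z
  linear_combination (2 * Z * t⁻¹ ^ k * X * Y) * e

/-- Rescaling space by `t` turns the heat kernel at time `t²` into the Gaussian density. -/
theorem integral_heatKern_smul {n : ℕ} (hn : 1 ≤ n) (α : ℝ) {V : Type*} [NormedAddCommGroup V]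
    [NormedSpace ℝ V] (f : Euc n → V) {t : ℝ} (ht : 0 < t) :
    ∫ x, heatKern n α x t • f x =
      -((2 * t * Real.exp (-α ^ 2 * t ^ 2)) • ∫ y, gaussDensity n y • f (t • y)) := by
  have h := Measure.integral_comp_smul (volume : Measure (Euc n))
    (fun x => gaussDensity n (t⁻¹ • x) • f x) t
  simp only [inv_smul_smul₀ ht.ne', finrank_euclideanSpace, Fintype.card_fin] at h
  rw [abs_of_nonneg (by positivity), ← inv_pow] at h
  simp_rw [heatKern_eq hn α _ ht, mul_smul]
  rw [integral_smul, integral_smul, h, neg_smul]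
  simp only [mul_smul]

theorem measurable_heatKern (n : ℕ) (α : ℝ) :
    Measurable fun p : Euc n × ℝ => heatKern n α p.1 p.2 := by
  unfold heatKern besselKern
  fun_prop

theorem integrable_heatKern_left {n : ℕ} (hn : 1 ≤ n) (α : ℝ) {t : ℝ} (ht : 0 < t) :
    Integrable fun x : Euc n => heatKern n α x t := by
  simp_rw [heatKern_eq hn α _ ht]
  refine Integrable.const_mul (Integrable.const_mul ?_ _) _
  exact (integrable_comp_smul_iff volume _ (inv_ne_zero ht.ne')).2 (integrable_gaussDensity n)

theorem norm_heatKern {n : ℕ} (α : ℝ) (x : Euc n) {t : ℝ} (ht : 0 < t) :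
    ‖heatKern n α x t‖ = -heatKern n α x t := by
  refine Real.norm_of_nonpos ?_
  refine mul_nonpos_of_nonpos_of_nonneg ?_ (besselKern_nonneg _ _ _ ht)
  rw [heatConst, neg_nonpos]
  positivity

theorem integrable_heatKern {n : ℕ} (hn : 1 ≤ n) {α : ℝ} (hα : 0 < α) :
    Integrable (fun p : Euc n × ℝ => heatKern n α p.1 p.2)
      ((volume : Measure (Euc n)).prod (volume.restrict (Set.Ioi 0))) := by
  rw [integrable_prod_iff' (measurable_heatKern n α).aestronglyMeasurable]
  refine ⟨(ae_restrict_iff' measurableSet_Ioi).2 (.of_forall fun t ht =>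
    integrable_heatKern_left hn α ht), ?_⟩
  have h : Integrable fun t : ℝ => 2 * (t * Real.exp (-α ^ 2 * t ^ 2)) :=
    (integrable_mul_exp_neg_mul_sq (b := α ^ 2) (by positivity)).const_mul 2
  refine h.integrableOn.congr ((ae_restrict_iff' measurableSet_Ioi).2 (.of_forall fun t ht => ?_))
  have h1 := integral_heatKern_smul hn α (fun _ : Euc n => (1 : ℝ)) ht
  simp only [smul_eq_mul, mul_one, integral_gaussDensity] at h1
  simp_rw [norm_heatKern α _ (Set.mem_Ioi.1 ht)]
  rw [integral_neg, h1]
  ring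

theorem euclidKernel_ae_eq {n : ℕ} (hn : 1 ≤ n) {α : ℝ} (hα : 0 < α) :
    ∀ᵐ x : Euc n, euclidKernel n α x = ((∫ t in Set.Ioi 0, heatKern n α x t : ℝ) : ℂ) := by
  have : Nonempty (Fin n) := ⟨⟨0, hn⟩⟩
  filter_upwards [(Set.countable_singleton (0 : Euc n)).ae_notMem volume] with x hx
  rw [euclidKernel_eq hn hα hx]
  simp_rw [heatKern]
  rw [integral_const_mul]
  rfl

theorem integrable_euclidKernel {n : ℕ} (hn : 1 ≤ n) {α : ℝ} (hα : 0 < α) :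
    Integrable (euclidKernel n α) :=
  ((integrable_heatKern hn hα).integral_prod_left.ofReal (𝕜 := ℂ)).congr
    ((euclidKernel_ae_eq hn hα).mono fun _ h => h.symm)

theorem integrable_heatKern_smul {n : ℕ} (hn : 1 ≤ n) {α : ℝ} (hα : 0 < α) {f : Euc n → ℂ}
    (hf : Continuous f) {B : ℝ} (hB : ∀ x, ‖f x‖ ≤ B) :
    Integrable (fun p : Euc n × ℝ => heatKern n α p.1 p.2 • f p.1)
      ((volume : Measure (Euc n)).prod (volume.restrict (Set.Ioi 0))) := by
  refine ((integrable_heatKern hn hα).norm.mul_const B).mono'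
    ((measurable_heatKern n α).smul (hf.measurable.comp measurable_fst)).aestronglyMeasurable
    (.of_forall fun p => ?_)
  rw [norm_smul]
  exact mul_le_mul_of_nonneg_left (hB _) (norm_nonneg _)

theorem integral_euclidKernel_mul {n : ℕ} (hn : 1 ≤ n) {α : ℝ} (hα : 0 < α) {f : Euc n → ℂ}
    (hf : Continuous f) {B : ℝ} (hB : ∀ x, ‖f x‖ ≤ B) :
    ∫ x, euclidKernel n α x * f x =
      -∫ t in Set.Ioi 0, (2 * t * Real.exp (-α ^ 2 * t ^ 2)) • gaussAverage f t := by
  have h1 : ∫ x, euclidKernel n α x * f x =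
      ∫ x, ∫ t in Set.Ioi 0, heatKern n α x t • f x := by
    refine integral_congr_ae ((euclidKernel_ae_eq hn hα).mono fun x hx => ?_)
    simp only [hx]
    rw [integral_smul_const, Complex.real_smul]
  rw [h1, integral_integral_swap (integrable_heatKern_smul hn hα hf hB), ← integral_neg]
  exact setIntegral_congr_fun measurableSet_Ioi fun t ht => integral_heatKern_smul hn α f ht

theorem continuous_laplacian {n : ℕ} {ψ : Euc n → ℂ} (hψ : ContDiff ℝ ∞ ψ) :
    Continuous (Δ ψ) := by
  have h1 : Continuous (iteratedFDeriv ℝ 2 ψ) :=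
    (contDiff_infty.1 hψ 2).continuous_iteratedFDeriv le_rfl
  rw [InnerProductSpace.laplacian_eq_iteratedFDeriv_stdOrthonormalBasis]
  exact continuous_finsetSum _ fun i _ =>
    (ContinuousMultilinearMap.apply ℝ (fun _ : Fin 2 => Euc n) ℂ _).continuous.comp h1

theorem continuous_kleinGordon {n : ℕ} (α : ℝ) {ψ : Euc n → ℂ} (hψ : ContDiff ℝ ∞ ψ) :
    Continuous (kleinGordon α ψ) :=
  (continuous_laplacian hψ).sub (continuous_const.mul hψ.continuous)

theorem HasBoundedDerivs.exists_norm_le {n : ℕ} {ψ : Euc n → ℂ} (hb : HasBoundedDerivs ψ) :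
    ∃ B, ∀ x, ‖ψ x‖ ≤ B ∧ ‖Δ ψ x‖ ≤ B := by
  obtain ⟨B, hB⟩ := hb
  refine ⟨max B (n * B), fun x => ⟨le_max_of_le_left ?_, le_max_of_le_right ?_⟩⟩
  · rw [← norm_iteratedFDeriv_zero (𝕜 := ℝ)]
    exact hB 0 (by norm_num) x
  · rw [InnerProductSpace.laplacian_eq_iteratedFDeriv_orthonormalBasis ψ
      (EuclideanSpace.basisFun (Fin n) ℝ)]
    refine (norm_sum_le_of_le (f := fun i => iteratedFDeriv ℝ 2 ψ x
        ![EuclideanSpace.basisFun (Fin n) ℝ i, EuclideanSpace.basisFun (Fin n) ℝ i])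
      (n := fun _ => B) _ fun i _ => ?_).trans (by simp)
    refine (ContinuousMultilinearMap.le_opNorm _ _).trans ?_
    simp only [Fin.prod_univ_two, Matrix.cons_val_zero, Matrix.cons_val_one,
      OrthonormalBasis.norm_eq_one, mul_one]
    exact hB 2 le_rfl x

/-- The Euclidean kernel is a fundamental solution of `Δ - α²` for test functions with bounded
derivatives: as `t` grows, `e^{-α²t²} ∫ g(y) ψ(ty) dy` runs from `ψ(0)` to `0`, and its
derivative is `2t e^{-α²t²}` times the average of `(Δ - α²)ψ`. -/
theorem integral_euclidKernel_mul_kleinGordon {n : ℕ} (hn : 1 ≤ n) {α : ℝ} (hα : 0 < α)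
    {ψ : Euc n → ℂ} (hψ : ContDiff ℝ ∞ ψ) (hb : HasBoundedDerivs ψ) :
    Integrable (fun x => euclidKernel n α x * kleinGordon α ψ x) ∧
      ∫ x, euclidKernel n α x * kleinGordon α ψ x = ψ 0 := by
  obtain ⟨B, hB⟩ := hb.exists_norm_le
  have hB0 : 0 ≤ B := (norm_nonneg _).trans (hB 0).1
  have hc := continuous_kleinGordon α hψ
  have hLB (x : Euc n) : ‖kleinGordon α ψ x‖ ≤ B + α ^ 2 * B := by
    refine (norm_sub_le _ _).trans ?_
    rw [norm_mul, norm_pow, Complex.norm_real, Real.norm_eq_abs, sq_abs]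
    gcongr
    · exact (hB x).2
    · exact (hB x).1
  refine ⟨((integrable_euclidKernel hn hα).norm.mul_const (B + α ^ 2 * B)).mono'
    ((integrable_euclidKernel hn hα).aestronglyMeasurable.mul hc.aestronglyMeasurable)
    (.of_forall fun x => ?_), ?_⟩
  · rw [norm_mul]
    exact mul_le_mul_of_nonneg_left (hLB x) (norm_nonneg _)
  rw [integral_euclidKernel_mul hn hα hc hLB]
  have hi (t : ℝ) : gaussAverage (kleinGordon α ψ) t =
      gaussAverage (Δ ψ) t - α ^ 2 • gaussAverage ψ t := by
    simp only [gaussAverage, kleinGordon]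
    rw [← integral_smul, ← integral_sub]
    · congr 1
      funext y
      rw [smul_sub, smul_comm (α ^ 2), Complex.real_smul (x := α ^ 2)]
      push_cast
      rfl
    · exact integrable_gaussDensity_smul ((continuous_laplacian hψ).comp (continuous_const_smul t))
        fun x => (hB _).2
    · exact (integrable_gaussDensity_smul (hψ.continuous.comp (continuous_const_smul t))
        fun x => (hB _).1).smul _
  have hd (t : ℝ) : HasDerivAt (fun t : ℝ => Real.exp (-α ^ 2 * t ^ 2) • gaussAverage ψ t)
      ((2 * t * Real.exp (-α ^ 2 * t ^ 2)) • gaussAverage (kleinGordon α ψ) t) t := by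
    have h1 : HasDerivAt (fun t : ℝ => Real.exp (-α ^ 2 * t ^ 2)) _ t :=
      (((hasDerivAt_id t).fun_pow 2).const_mul (-α ^ 2)).exp
    refine HasDerivAt.congr_deriv (h1.fun_smul (hasDerivAt_gaussAverage hψ hb t)) ?_
    rw [hi, id_eq]
    simp only [Complex.real_smul]
    push_cast
    ring
  have hlim : Filter.Tendsto (fun t : ℝ => Real.exp (-α ^ 2 * t ^ 2) • gaussAverage ψ t)
      Filter.atTop (nhds 0) := by
    refine squeeze_zero_norm (a := fun t => Real.exp (-α ^ 2 * t ^ 2) * B) (fun t => ?_) ?_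
    · rw [norm_smul, Real.norm_of_nonneg (Real.exp_pos _).le]
      gcongr
      calc ‖gaussAverage ψ t‖ ≤ ∫ y, gaussDensity n y * B := by
            refine norm_integral_le_of_norm_le ((integrable_gaussDensity n).mul_const B)
              (.of_forall fun y => ?_)
            rw [norm_smul, Real.norm_of_nonneg (gaussDensity_nonneg y)]
            exact mul_le_mul_of_nonneg_left (hB _).1 (gaussDensity_nonneg y)
        _ = B := by rw [integral_mul_const, integral_gaussDensity, one_mul]
    · rw [← zero_mul B]
      refine Filter.Tendsto.mul_const B (Real.tendsto_exp_atBot.comp ?_)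
      exact (Filter.tendsto_pow_atTop two_ne_zero).const_mul_atTop_of_neg
        (neg_neg_of_pos (by positivity))
  have hint : IntegrableOn (fun t : ℝ => (2 * t * Real.exp (-α ^ 2 * t ^ 2)) •
      gaussAverage (kleinGordon α ψ) t) (Set.Ioi 0) := by
    refine (integrable_heatKern_smul hn hα hc hLB).integral_prod_right.neg.congr
      ((ae_restrict_iff' measurableSet_Ioi).2 (.of_forall fun t ht => ?_))
    simp only [Pi.neg_apply]
    rw [integral_heatKern_smul hn α _ ht, neg_neg]
    rfl
  rw [integral_Ioi_of_hasDerivAt_of_tendsto' (fun t _ => hd t) hint hlim, zero_sub, neg_neg]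
  simp only [gaussAverage, zero_smul]
  rw [integral_smul_const, integral_gaussDensity]
  simp

/-! ### Test functions on the Klein bottle -/

theorem kleinMap_two_mul {n : ℕ} (m : Fin n → ℤ) (x : Euc n) :
    kleinMap (fun i => 2 * m i) x = x + latticeVec fun i => 2 * m i := by
  ext i
  simp [kleinMap, reflectLast, lastSign, Int.negOnePow_two_mul]

theorem paritySign_two_mul {n : ℕ} (l : ℕ) (m : Fin n → ℤ) :
    paritySign l (fun i => 2 * m i) = 1 := by
  rw [paritySign, ← Finset.mul_sum]
  exact (even_two_mul _).neg_one_zpow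

/-- Equivariant functions are periodic under the lattice `2ℤⁿ`, on which reflections and signs
are trivial. -/
theorem IsEquivariant.add_latticeVec_two_mul {n l : ℕ} {ψ : Euc n → ℂ} (h : IsEquivariant l ψ)
    (m : Fin n → ℤ) (x : Euc n) : ψ (x + latticeVec fun i => 2 * m i) = ψ x := by
  rw [← kleinMap_two_mul, h, paritySign_two_mul, one_smul]

theorem exists_norm_le_of_periodic {n : ℕ} {V : Type*} [NormedAddCommGroup V] {f : Euc n → V}
    (hf : Continuous f)
    (hp : ∀ (m : Fin n → ℤ) (x : Euc n), f (x + latticeVec fun i => 2 * m i) = f x) :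
    ∃ B, ∀ x, ‖f x‖ ≤ B := by
  obtain ⟨B, hB⟩ := (isCompact_closedBall (0 : Euc n) (2 * n)).exists_bound_of_continuousOn
    hf.continuousOn
  refine ⟨B, fun x => ?_⟩
  -- halving and rounding reduces `x` modulo `2ℤⁿ` to twice a point of the cell
  let y : Euc n := WithLp.toLp 2 fun i => x i / 2 - round (x i / 2)
  have hy : y ∈ kleinCell n := by
    intro i
    have h := abs_le.1 (abs_sub_round (x i / 2))
    exact ⟨by rw [neg_div]; exact h.1, h.2⟩
  have hx : x = (2 : ℝ) • y + latticeVec fun i => 2 * round (x i / 2) := by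
    ext i
    simp only [y, latticeVec, PiLp.add_apply, PiLp.smul_apply, smul_eq_mul]
    push_cast
    ring
  rw [hx, hp]
  refine hB _ (mem_closedBall_zero_iff.2 ?_)
  rw [norm_smul, Real.norm_of_nonneg zero_le_two]
  exact mul_le_mul_of_nonneg_left (norm_le_of_mem_kleinCell hy) zero_le_two

theorem IsEquivariant.hasBoundedDerivs {n l : ℕ} {ψ : Euc n → ℂ} (h : IsEquivariant l ψ)
    (hψ : ContDiff ℝ ∞ ψ) : HasBoundedDerivs ψ := by
  have hj (j : ℕ) : ∃ B, ∀ x, ‖iteratedFDeriv ℝ j ψ x‖ ≤ B := by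
    refine exists_norm_le_of_periodic ((contDiff_infty.1 hψ j).continuous_iteratedFDeriv le_rfl)
      fun m x => ?_
    rw [← iteratedFDeriv_comp_add_right]
    congr 1
    funext y
    exact h.add_latticeVec_two_mul m y
  choose B hB using hj
  refine ⟨max (B 0) (max (B 1) (B 2)), fun j hj x => (hB j x).trans ?_⟩
  interval_cases j <;> simp

/-! ### Integration over the Klein bottle -/

theorem integrable_tsum_of_summable_integral_norm {ι X V : Type*} [Countable ι]
    [MeasurableSpace X] {μ : Measure X} [NormedAddCommGroup V]
    {F : ι → X → V} (hF : ∀ i, Integrable (F i) μ) (hs : Summable fun i => ∫ x, ‖F i x‖ ∂μ)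
    (hm : AEStronglyMeasurable (fun x => ∑' i, F i x) μ) :
    Integrable (fun x => ∑' i, F i x) μ := by
  refine ⟨hm, ?_⟩
  have hle (x : X) : ‖∑' i, F i x‖ₑ ≤ ∑' i, ‖F i x‖ₑ := by
    by_cases h : ∑' i, ‖F i x‖ₑ = ⊤
    · rw [h]
      exact le_top
    · simp only [enorm_eq_nnnorm] at h ⊢
      have h' := ENNReal.tsum_coe_ne_top_iff_summable.1 h
      rw [← ENNReal.coe_tsum h']
      exact_mod_cast nnnorm_tsum_le h'
  refine (lintegral_mono hle).trans_lt ?_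
  rw [lintegral_tsum fun i => (hF i).1.enorm]
  simp_rw [← ofReal_integral_norm_eq_lintegral_enorm (hF _)]
  rw [← ENNReal.ofReal_tsum_of_nonneg (fun i => integral_nonneg fun _ => norm_nonneg _) hs]
  exact ENNReal.ofReal_lt_top

theorem measurable_twistedSum {n : ℕ} (hn : 1 ≤ n) (l : ℕ) {α : ℝ} (hα : 0 < α) :
    Measurable (twistedSum (n := n) l α) := by
  refine measurable_of_measurable_on_compl_countable (lattice n) (countable_lattice n) ?_
  refine (continuousOn_iff_continuous_domRestrict.1 fun x hx => ?_).measurable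
  exact (contDiffAt_twistedSum hn l hα hx).continuousAt.continuousWithinAt

theorem twistedTerm_mul_eq {n l : ℕ} (α : ℝ) {f : Euc n → ℂ} (hf : IsEquivariant l f)
    (m : Fin n → ℤ) (x : Euc n) :
    twistedTerm l α m x * f x = euclidKernel n α (kleinMap m x) * f (kleinMap m x) := by
  rw [hf m x, twistedTerm, smul_eq_mul]
  ring

theorem integrableOn_twistedSum {n : ℕ} (hn : 1 ≤ n) (l : ℕ) {α : ℝ} (hα : 0 < α) :
    IntegrableOn (twistedSum (n := n) l α) (kleinCell n) := by
  have hE := integrable_euclidKernel hn hα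
  have hnorm (m : Fin n → ℤ) (x : Euc n) :
      ‖twistedTerm l α m x‖ = ‖euclidKernel n α (kleinMap m x)‖ := by
    rcases twistedTerm_cases l α m with h | h <;> simp [h]
  refine integrable_tsum_of_summable_integral_norm (fun m => ?_) ?_
    (measurable_twistedSum hn l hα).aestronglyMeasurable
  · exact ((((measurePreserving_kleinMap m).integrable_comp_emb
      (measurableEmbedding_kleinMap m)).2 hE).const_mul _).integrableOn
  · simp_rw [hnorm]
    exact (hasSum_setIntegral_kleinCell hE.norm).summable

/-- Unfolding: for equivariant `f`, the integral of `℘ f` over the cell is the integral of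
`E_α f` over `ℝⁿ`. -/
theorem setIntegral_twistedSum_mul {n : ℕ} (l : ℕ) {α : ℝ} {f : Euc n → ℂ}
    (hf : IsEquivariant l f) (hi : Integrable fun x => euclidKernel n α x * f x) :
    ∫ x in kleinCell n, twistedSum l α x * f x = ∫ x, euclidKernel n α x * f x := by
  have h := hasSum_integral_of_summable_integral_norm (μ := volume.restrict (kleinCell n))
    (F := fun (m : Fin n → ℤ) x => euclidKernel n α (kleinMap m x) * f (kleinMap m x))
    (fun m => (((measurePreserving_kleinMap m).integrable_comp_emb
      (measurableEmbedding_kleinMap m)).2 hi).integrableOn)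
    (hasSum_setIntegral_kleinCell hi.norm).summable
  rw [(hasSum_setIntegral_kleinCell hi).unique h]
  simp_rw [← twistedTerm_mul_eq α hf, tsum_mul_right]
  rfl

theorem setIntegral_twistedSum_mul_kleinGordon {n : ℕ} (hn : 1 ≤ n) (l : ℕ) {α : ℝ} (hα : 0 < α)
    {ψ : Euc n → ℂ} (hψ : ContDiff ℝ ∞ ψ) (he : IsEquivariant l ψ) :
    ∫ x in kleinCell n, twistedSum l α x * kleinGordon α ψ x = ψ 0 := by
  obtain ⟨hi, h⟩ := integral_euclidKernel_mul_kleinGordon hn hα hψ (he.hasBoundedDerivs hψ)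
  rw [setIntegral_twistedSum_mul l (kleinGordon_equivariant α ψ he) hi, h]

theorem integral_kleinVolume {n : ℕ} {g : KleinBottle n → ℂ}
    (hg : Measurable fun x : Euc n => g (toKlein x)) :
    ∫ x', g x' ∂(kleinVolume n) = ∫ x in kleinCell n, g (toKlein x) := by
  have hg' : Measurable g := fun _ ht => hg ht
  rw [kleinVolume, integral_map measurable_toKlein.aemeasurable hg'.aestronglyMeasurable]

/-! ### Pinor sections -/

theorem clCoord_pinorKleinGordon {n l : ℕ} {ε : ℤˣ} (α : ℝ) (ψ : PinorLift n l ε)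
    (S : Finset (Fin n)) (x : Euc n) :
    clCoord S ((pinorKleinGordon α ψ).1 x) = kleinGordon α (fun y => clCoord S (ψ.1 y)) x := by
  classical
  simp [pinorKleinGordon, clCoord, Finsupp.single_apply]

theorem clCoord_sectionMul_scalarLift {n l : ℕ} {ε : ℤˣ} {f : Euc n → ℂ} (hf : IsEquivariant l f)
    (v : PinorLift n l ε) (S : Finset (Fin n)) (x : Euc n) :
    clCoord S (sectionMul (scalarLift ε f hf) v (toKlein x)) = f x * clCoord S (v.1 x) := by
  have h : sectionMul (scalarLift ε f hf) v (toKlein x) = f x • v.1 x :=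
    (Algebra.smul_def (f x) (v.1 x)).symm
  rw [h, map_smul, smul_eq_mul]

theorem isFundamentalSolution_twistedSum {n : ℕ} (hn : 1 ≤ n) (l : ℕ) (ε : ℤˣ) {α : ℝ} (hα : 0 < α)
    (h : IsEquivariant l (twistedSum (n := n) l α)) :
    IsFundamentalSolution α (descend (scalarLift ε (twistedSum (n := n) l α) h)) := by
  refine ⟨_, rfl, fun S => ?_, fun ψ hψ => ?_⟩
  · have hS (x : Euc n) : clCoord S ((scalarLift ε (twistedSum (n := n) l α) h).1 x) =
        twistedSum l α x * clCoord S (1 : Cl n ε) := by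
      rw [← smul_eq_mul, ← map_smul, ← Algebra.algebraMap_eq_smul_one]
      rfl
    simp_rw [hS]
    exact (integrableOn_twistedSum hn l hα).mul_const _
  · have hS (S : Finset (Fin n)) :
        ∫ x', clCoord S (sectionMul (scalarLift ε (twistedSum (n := n) l α) h)
          (pinorKleinGordon α ψ) x') ∂(kleinVolume n) = clCoord S (ψ.1 0) := by
      have hx (x : Euc n) : clCoord S (sectionMul (scalarLift ε (twistedSum (n := n) l α) h)
          (pinorKleinGordon α ψ) (toKlein x)) =
          twistedSum l α x * kleinGordon α (fun y => clCoord S (ψ.1 y)) x := by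
        rw [clCoord_sectionMul_scalarLift, clCoord_pinorKleinGordon]
      rw [integral_kleinVolume (g := fun x' => clCoord S (sectionMul
        (scalarLift ε (twistedSum (n := n) l α) h) (pinorKleinGordon α ψ) x'))]
      · simp_rw [hx]
        exact setIntegral_twistedSum_mul_kleinGordon hn l hα (hψ S) (clCoord_equivariant ψ S)
      · simp_rw [hx]
        exact (measurable_twistedSum hn l hα).mul (continuous_kleinGordon α (hψ S)).measurable
    rw [kleinIntegral]
    simp_rw [hS]
    exact (clBasis n ε).sum_repr (ψ.1 0)

end PinorKlein

theorem mainTheorem1 (n l : ℕ) (hn : 1 ≤ n) (hl : l ≤ n) (ε : ℤˣ) (α : ℝ) (hα : 0 < α) :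
    -- normal convergence on `ℝⁿ ∖ Λ_n`
    (∀ C : Set (Euc n), IsCompact C → Disjoint C (lattice n) →
      ∃ b : (Fin n → ℤ) → ℝ, Summable b ∧
        ∀ m : Fin n → ℤ, ∀ x ∈ C, ‖twistedTerm l α m x‖ ≤ b m) ∧
    -- the sum lies in `Ker (Δ - α²)` on `ℝⁿ ∖ Λ_n`
    (∀ x : Euc n, x ∉ lattice n →
      ContDiffAt ℝ ∞ (twistedSum (n := n) l α) x ∧
        kleinGordon α (twistedSum (n := n) l α) x = 0) ∧
    -- pseudo-periodicity
    (∀ (k : Fin n → ℤ) (x : Euc n),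
      twistedSum l α (x + latticeVec k) = paritySign l k * twistedSum l α (reflectLast k x)) ∧
    -- the sum descends to a section of the pinor bundle, which is a fundamental solution
    ∃ h : IsEquivariant l (twistedSum (n := n) l α),
      IsFundamentalSolution α (descend (scalarLift ε (twistedSum (n := n) l α) h)) := by
  refine ⟨fun C hC hd => ?_, fun x hx => ⟨contDiffAt_twistedSum hn l hα hx,
    kleinGordon_twistedSum hn l hα hx⟩, twistedSum_add_latticeVec l α,
    isEquivariant_twistedSum n l α, isFundamentalSolution_twistedSum hn l ε hα _⟩
  obtain ⟨b, hb, h⟩ := exists_summable_norm_iteratedFDeriv_twistedTerm_le hn l hα hC hd 0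
  refine ⟨b, hb, fun m x hx => ?_⟩
  rw [← norm_iteratedFDeriv_zero (𝕜 := ℝ)]
  exact h m x hx
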